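/- There are $n\ge 1$ candidates, divided into an advantaged group $G_1$ and a disadvantaged group $G_2$, and $p$ institutions with capacities $k_1,\dots,k_p$; put $K=\sum_{\ell}k_\ell$ and assume $K\le n$. Candidate $i$ has a true utility $u_i\ge 0$ and a preference list $\sigma_i$, a ranking of all $p$ institutions. The utilities $u_1,\dots,u_n$ have law $\mathcal D$, an arbitrary probability distribution on $[0,\infty)$, the lists $\sigma_1,\dots,\sigma_n$ have law $\mathcal L$, an arbitrary probability distribution on the set of preference lists, and all of these are independent. For a bias parameter $\beta>0$ the estimated utility is $\hat u_i=u_i$ if $i\in G_1$ and $\hat u_i=\beta u_i$ if $i\in G_2$. The algorithm $\mathcal A_{\rm st}$, given a set of candidates with their preference lists and estimated utilities, and capacities of the institutions, considers the candidates in decreasing order of estimated utility (ties are broken by the index) and assigns each one to its most preferred institution that still has a vacant slot, if there is one. The algorithm $\mathcal A_{\rm inst\text{-}wise}$ runs $\mathcal A_{\rm st}$ separately on $G_1$ and on $G_2$, where in the run on $G_j$ institution $\ell$ has capacity $k_\ell|G_j|/n$, and returns the union $M$ of the two assignments. Assume that all the numbers $k_\ell|G_j|/n$ are integers. Let $\rho_j$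 be the fraction of the candidates in $G_j$ that $M$ assigns to some institution, let $\pi_j$ be the fraction of the candidates in $G_j$ that $M$ assigns to their first choice, let $\mathsf U(M)$ be the sum of the true utilities $u_i$ of the candidates that $M$ assigns to some institution, and let $\mathsf U^\star$ be the sum of the $K$ largest entries of $(u_1,\dots,u_n)$. Put $$\mathscr R=\mathbb E\,\frac{\min(\rho_1,\rho_2)}{\max(\rho_1,\rho_2)},\qquad \mathscr P=\mathbb E\,\frac{\min(\pi_1,\pi_2)}{\max(\pi_1,\pi_2)},\qquad \mathscr U=\mathbb E\,\frac{\mathsf U(M)}{\mathsf U^\star},$$ where the last quotient is read as $1$ when $\mathsf U^\star=0$. Theorem. There is an absolute constant $C>0$ such that the following holds. Let $\eta_1,\eta_2,\eta_3>0$ be such that $|G_j|\ge\eta_1 n$ for $j\in\{1,2\}$, $K\ge\eta_2 n$, and $k_\ell\ge\eta_3K$ for every $\ell\in\{1,\dots,p\}$. Then, for all $\mathcal D$, $\mathcal L$ and $\beta$ as above, the algorithm $\mathcal A_{\rm inst\text{-}wise}$ satisfies $$\mathscr P\ \ge\ 1-C\,\frac{p\sqrt{\log K}}{\eta_1\eta_3\sqrt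 K},\qquad \mathscr U\ \ge\ 1-C\,\frac{\sqrt{\log n}}{\sqrt{\eta_2 n}},\qquad \mathscr R=1 .$$ -/

import Mathlib

open MeasureTheory

noncomputable section

namespace Selection

/-- A preference list over the institutions `Fin p`: `s r` is the institution in position `r`,
so `s 0` is the first choice. -/
abbrev PrefList (p : ℕ) : Type := Equiv.Perm (Fin p)

/-- Every set of preference lists is an event. -/
instance instMeasurableSpacePrefList (p : ℕ) : MeasurableSpace (PrefList p) := ⊤

/-- A selection: a partial function from candidates to institutions. -/
abbrev Assignment (n p : ℕ) : Type := Fin n → Option (Fin p)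

/-! ### Algorithms -/

/-- The candidates in `S` in order of decreasing value of `v`. The sort is stable, so that
candidates with equal values stay in increasing order of their index. -/
def ranking {n : ℕ} (v : Fin n → ℝ) (S : Finset (Fin n)) : List (Fin n) :=
  (S.sort (fun a b => a ≤ b)).mergeSort (fun a b => decide (v b ≤ v a))

/-- The most preferred institution that has a vacant slot, if there is one. -/
def bestAvailable {p : ℕ} (c : Fin p → ℕ) (s : PrefList p) : Option (Fin p) :=
  (List.ofFn s).find? (fun l => decide (0 < c l))

/-- Process the candidates in the order of the list; each one receives the most preferred
institution that still has a vacant slot, and takes one of its slots. -/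
def serialDictatorship {n p : ℕ} (σ : Fin n → PrefList p) :
    List (Fin n) → (Fin p → ℕ) → Assignment n p
  | [], _ => fun _ => none
  | i :: rest, c =>
    match bestAvailable c (σ i) with
    | none => serialDictatorship σ rest c
    | some l =>
      Function.update (serialDictatorship σ rest (Function.update c l (c l - 1))) i (some l)

/-- The algorithm `A_st` on the set `S` of candidates with capacities `k`. -/
def stableAssignment {n p : ℕ} (S : Finset (Fin n)) (k : Fin p → ℕ)
    (σ : Fin n → PrefList p) (v : Fin n → ℝ) : Assignment n p :=
  serialDictatorship σ (ranking v S) k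

/-- The group with label `j`, for a labelling `g` of the candidates by two group labels:
`0` is the advantaged group and `1` the disadvantaged one. -/
def group {n : ℕ} (g : Fin n → Fin 2) (j : Fin 2) : Finset (Fin n) :=
  Finset.univ.filter (fun i => g i = j)

/-- The capacity `k l * |G_j| / n` reserved for the group `j` at institution `l`
(division of natural numbers, used where it is exact). -/
def groupCapacity {n p : ℕ} (g : Fin n → Fin 2) (k : Fin p → ℕ) (j : Fin 2) (l : Fin p) : ℕ :=
  k l * (group g j).card / n

/-- The algorithm `A_inst-wise`: `A_st` is run on each group separately, with the capacities
reserved for that group, and the two assignments are put together. -/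
def instWise {n p : ℕ} (g : Fin n → Fin 2) (k : Fin p → ℕ)
    (σ : Fin n → PrefList p) (v : Fin n → ℝ) : Assignment n p :=
  fun i => stableAssignment (group g (g i)) (groupCapacity g k (g i)) σ v i

/-! ### Metrics of an assignment -/

/-- Estimated utilities: those of the disadvantaged group are multiplied by `β`. -/
def estimated {n : ℕ} (β : ℝ) (g : Fin n → Fin 2) (u : Fin n → ℝ) : Fin n → ℝ :=
  fun i => if g i = 1 then β * u i else u i

/-- The total true utility of the candidates assigned to some institution. -/
def utility {n p : ℕ} (u : Fin n → ℝ) (M : Assignment n p) : ℝ :=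
  ∑ i ∈ Finset.univ.filter (fun i => (M i).isSome), u i

/-- The sum of the `K` largest entries of `u`. -/
def optUtility {n : ℕ} (K : ℕ) (u : Fin n → ℝ) : ℝ :=
  (((ranking u Finset.univ).take K).map u).sum

/-- The utility of `M` relative to the optimum; the ratio is `1` where the optimum is `0`
(then every selection is optimal). -/
def utilityQuotient {n p : ℕ} (K : ℕ) (u : Fin n → ℝ) (M : Assignment n p) : ℝ :=
  if optUtility K u = 0 then 1 else utility u M / optUtility K u

/-- The fraction of group `j` that is selected. -/
def selectedFraction {n p : ℕ} (g : Fin n → Fin 2) (M : Assignment n p) (j : Fin 2) : ℝ :=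
  (((group g j).filter (fun i => (M i).isSome)).card : ℝ) / ((group g j).card : ℝ)

open Classical in
/-- The fraction of group `j` that is assigned to its first choice. -/
def firstChoiceFraction {n p : ℕ} (g : Fin n → Fin 2) (σ : Fin n → PrefList p)
    (M : Assignment n p) (j : Fin 2) : ℝ :=
  (((group g j).filter (fun i => ∃ h : 0 < p, M i = some (σ i ⟨0, h⟩))).card : ℝ) /
    ((group g j).card : ℝ)

/-- The quotient of the minimum and the maximum of a quantity over the two groups. -/
def minMaxQuotient (x : Fin 2 → ℝ) : ℝ := min (x 0) (x 1) / max (x 0) (x 1)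

/-! ### Expected metrics of an algorithm -/

/-- An algorithm sees the preference lists and the estimated utilities. -/
abbrev Algorithm (n p : ℕ) : Type := (Fin n → PrefList p) → (Fin n → ℝ) → Assignment n p

/-- The law of the true utilities and preference lists: all independent, utilities with law `D`
and lists with law `L`. -/
def instanceLaw (n p : ℕ) (D : Measure ℝ) (L : Measure (PrefList p)) :
    Measure ((Fin n → ℝ) × (Fin n → PrefList p)) :=
  (Measure.pi (fun _ : Fin n => D)).prod (Measure.pi (fun _ : Fin n => L))

/-- Utility ratio of an algorithm, for total capacity `K`. -/
def utilityRatio {n p : ℕ} (D : Measure ℝ) (L : Measure (PrefList p)) (β : ℝ)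
    (g : Fin n → Fin 2) (K : ℕ) (A : Algorithm n p) : ℝ :=
  ∫ x, utilityQuotient K x.1 (A x.2 (estimated β g x.1)) ∂(instanceLaw n p D L)

/-- Representational fairness of an algorithm. -/
def representationalFairness {n p : ℕ} (D : Measure ℝ) (L : Measure (PrefList p)) (β : ℝ)
    (g : Fin n → Fin 2) (A : Algorithm n p) : ℝ :=
  ∫ x, minMaxQuotient (selectedFraction g (A x.2 (estimated β g x.1))) ∂(instanceLaw n p D L)

/-- Preference-based fairness of an algorithm. -/
def preferenceFairness {n p : ℕ} (D : Measure ℝ) (L : Measure (PrefList p)) (β : ℝ)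
    (g : Fin n → Fin 2) (A : Algorithm n p) : ℝ :=
  ∫ x, minMaxQuotient (firstChoiceFraction g x.2 (A x.2 (estimated β g x.1)))
    ∂(instanceLaw n p D L)

end Selection

end

namespace Selection

/-! All reserved slots get filled, so each group has the selected fraction `K / n`. This gives the
value `1` for representational fairness (`selectedFraction_instWise`).

Utility: inside a group the bias does not change the order, so the algorithm takes the truly best
candidates of each group, as many as the group has slots. The utilities are exchangeable, so it
suffices to fix their values and average over all permutations (`le_sum_perm_utilityQuotient`). Let
`T` be the set of the top `K` values. If `X` of them land in a group with `c` slots, the group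
collects at least the share `min (1, c / X)` of their sum. By symmetry every element of `T` has the
same average weight, so the relative loss is at most the mean of `|X - c|` divided by `K`. Here `c`
is the mean of `X`, and sampling without replacement has variance at most `K`, so the loss is at
most `1 / √K`.

Preferences: with the utilities fixed, each group is a serial dictatorship on a word of i.i.d.
lists, with capacities `s_j * k` where `s_j = |G_j| / n`. The two groups are compared through one
auxiliary run on `2 * K` i.i.d. lists with capacities `2 * k`. Its candidates receive independent
random labels, `1` slightly too often and `2` slightly too rarely. A label class run alone with the
slots it used in the full run reproduces the same first choices (`firstChoiceCount_filter`). Given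
the lists, Hoeffding's inequality shows that class `1` uses at least `c₁` and class `2` at most `c₂`
slots at every institution, and that both get nearly their share of the first choices. The number of
first choices is monotone in the capacities (`firstChoiceCount_mono`), so passing to the exact
capacities `c₁` and `c₂` preserves an inequality between the two counts. Given the labels, the two
classes are again i.i.d. words, so the inequality transfers to the groups
(`measureReal_firstChoiceCount_lt_le`). Exchanging the roles of the groups gives the reverse
inequality. -/

/-- The institution `o`, if any, is the first entry of the preference list `s`. -/
def IsFirstChoice {p : ℕ} (s : PrefList p) (o : Option (Fin p)) : Prop :=
  ∃ h : 0 < p, o = some (s ⟨0, h⟩)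

/-! ### One step of the algorithm -/

theorem bestAvailable_eq_none {p : ℕ} {c : Fin p → ℕ} {s : PrefList p} :
    bestAvailable c s = none ↔ ∀ l, c l = 0 := by
  unfold bestAvailable
  rw [List.find?_eq_none]
  constructor
  · intro h l
    have := h l (by rw [List.mem_ofFn]; exact ⟨s.symm l, by simp⟩)
    simpa using this
  · intro h l _
    simp [h l]

theorem bestAvailable_eq_some {p : ℕ} {c : Fin p → ℕ} {s : PrefList p} {l : Fin p} :
    bestAvailable c s = some l ↔ 0 < c l ∧ ∀ r, r < s.symm l → c (s r) = 0 := by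
  unfold bestAvailable
  rw [List.find?_ofFn_eq_some]
  constructor
  · rintro ⟨h1, i, rfl, h2⟩
    refine ⟨by simpa using h1, fun r hr => ?_⟩
    rw [Equiv.symm_apply_apply] at hr
    simpa using h2 r hr
  · rintro ⟨h1, h2⟩
    exact ⟨by simpa using h1, s.symm l, by simp, fun r hr => by simpa using h2 r hr⟩

theorem sum_update_pred {p : ℕ} {c : Fin p → ℕ} {l : Fin p} (h : 0 < c l) :
    ∑ m, Function.update c l (c l - 1) m + 1 = ∑ m, c m := by
  rw [Finset.sum_update_of_mem (Finset.mem_univ l),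
    ← Finset.add_sum_erase _ c (Finset.mem_univ l), Finset.sdiff_singleton_eq_erase]
  omega

/-! ### Serial dictatorship -/

section SerialDictatorship

variable {n p : ℕ} (σ : Fin n → PrefList p)

theorem serialDictatorship_cons_none {i : Fin n} {xs : List (Fin n)} {c : Fin p → ℕ}
    (h : bestAvailable c (σ i) = none) :
    serialDictatorship σ (i :: xs) c = serialDictatorship σ xs c := by
  simp [serialDictatorship, h]

theorem serialDictatorship_cons_some {i : Fin n} {xs : List (Fin n)} {c : Fin p → ℕ} {l : Fin p}
    (h : bestAvailable c (σ i) = some l) :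
    serialDictatorship σ (i :: xs) c =
      Function.update (serialDictatorship σ xs (Function.update c l (c l - 1))) i (some l) := by
  simp [serialDictatorship, h]

theorem serialDictatorship_of_eq_zero (xs : List (Fin n)) (c : Fin p → ℕ) (h : ∀ l, c l = 0)
    (i : Fin n) : serialDictatorship σ xs c i = none := by
  induction xs with
  | nil => rfl
  | cons x xs ih => rw [serialDictatorship_cons_none σ (bestAvailable_eq_none.2 h), ih]

/-- While a slot is vacant, every candidate is assigned. -/
theorem isSome_serialDictatorship (xs : List (Fin n)) (c : Fin p → ℕ) (i : Fin n) :
    (serialDictatorship σ xs c i).isSome ↔ i ∈ xs.take (∑ l, c l) := by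
  induction xs generalizing c with
  | nil => simp [serialDictatorship]
  | cons x xs ih =>
    cases hb : bestAvailable c (σ x) with
    | none =>
      have h := bestAvailable_eq_none.1 hb
      rw [serialDictatorship_of_eq_zero σ _ _ h, Finset.sum_eq_zero (fun l _ => h l)]
      simp
    | some l =>
      have h := (bestAvailable_eq_some.1 hb).1
      rw [serialDictatorship_cons_some σ hb, ← sum_update_pred h, List.take_succ_cons,
        List.mem_cons, ← ih]
      rcases eq_or_ne i x with rfl | hi
      · simp
      · simp [hi]

theorem countP_serialDictatorship_cons {x : Fin n} {xs : List (Fin n)} (hx : x ∉ xs)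
    {c : Fin p → ℕ} {l : Fin p} (hb : bestAvailable c (σ x) = some l)
    (P : Fin n → Option (Fin p) → Bool) :
    (x :: xs).countP (fun i => P i (serialDictatorship σ (x :: xs) c i)) =
      xs.countP (fun i => P i (serialDictatorship σ xs (Function.update c l (c l - 1)) i)) +
        if P x (some l) then 1 else 0 := by
  rw [List.countP_cons, serialDictatorship_cons_some σ hb, Function.update_self]
  congr 1
  refine List.countP_congr fun i hi => ?_
  rw [Function.update_of_ne (ne_of_mem_of_not_mem hi hx)]

theorem countP_serialDictatorship_le (xs : List (Fin n)) (hxs : xs.Nodup) (c : Fin p → ℕ)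
    (m : Fin p) :
    xs.countP (fun i => decide (serialDictatorship σ xs c i = some m)) ≤ c m := by
  induction xs generalizing c with
  | nil => simp
  | cons x xs ih =>
    rw [List.nodup_cons] at hxs
    cases hb : bestAvailable c (σ x) with
    | none =>
      have h := bestAvailable_eq_none.1 hb
      simp [serialDictatorship_of_eq_zero σ _ _ h]
    | some l =>
      have h := (bestAvailable_eq_some.1 hb).1
      rw [countP_serialDictatorship_cons σ hxs.1 hb (fun _ o => decide (o = some m))]
      have := ih hxs.2 (Function.update c l (c l - 1))
      rcases eq_or_ne m l with rfl | hm
      · rw [Function.update_self] at this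
        simp only [decide_true, if_true]
        omega
      · rw [Function.update_of_ne hm] at this
        simpa [hm.symm] using this

/-- If there are enough candidates, then all slots are filled. -/
theorem countP_serialDictatorship_eq (xs : List (Fin n)) (hxs : xs.Nodup) (c : Fin p → ℕ)
    (hc : ∑ l, c l ≤ xs.length) (m : Fin p) :
    xs.countP (fun i => decide (serialDictatorship σ xs c i = some m)) = c m := by
  induction xs generalizing c with
  | nil =>
    have : ∑ l, c l = 0 := by simpa using hc
    have := (Finset.sum_eq_zero_iff.1 this) m (Finset.mem_univ m)
    simp [this]
  | cons x xs ih =>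
    rw [List.nodup_cons] at hxs
    cases hb : bestAvailable c (σ x) with
    | none =>
      have h := bestAvailable_eq_none.1 hb
      simp [serialDictatorship_of_eq_zero σ _ _ h, h]
    | some l =>
      have h := (bestAvailable_eq_some.1 hb).1
      rw [countP_serialDictatorship_cons σ hxs.1 hb (fun _ o => decide (o = some m))]
      have hs := sum_update_pred h
      rw [List.length_cons] at hc
      have := ih hxs.2 (Function.update c l (c l - 1)) (by omega)
      rcases eq_or_ne m l with rfl | hm
      · rw [Function.update_self] at this
        simp only [decide_true, if_true]
        omega
      · rw [Function.update_of_ne hm] at this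
        simpa [hm.symm] using this

end SerialDictatorship

/-! ### The number of first choices -/

open Classical in
/-- The number of candidates that get their first choice when candidates with the preference lists
`ws` are processed in this order with capacities `c`. -/
noncomputable def firstChoiceCount {p : ℕ} : List (PrefList p) → (Fin p → ℕ) → ℕ
  | [], _ => 0
  | s :: ws, c =>
    match bestAvailable c s with
    | none => firstChoiceCount ws c
    | some l =>
      firstChoiceCount ws (Function.update c l (c l - 1)) +
        if IsFirstChoice s (some l) then 1 else 0

section FirstChoiceCount

variable {p : ℕ}

theorem firstChoiceCount_cons_none {s : PrefList p} {ws : List (PrefList p)} {c : Fin p → ℕ}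
    (h : bestAvailable c s = none) :
    firstChoiceCount (s :: ws) c = firstChoiceCount ws c := by
  simp [firstChoiceCount, h]

open Classical in
theorem firstChoiceCount_cons_some {s : PrefList p} {ws : List (PrefList p)} {c : Fin p → ℕ}
    {l : Fin p} (h : bestAvailable c s = some l) :
    firstChoiceCount (s :: ws) c = firstChoiceCount ws (Function.update c l (c l - 1)) +
      if IsFirstChoice s (some l) then 1 else 0 := by
  simp [firstChoiceCount, h]

theorem firstChoiceCount_of_eq_zero (ws : List (PrefList p)) {c : Fin p → ℕ}
    (h : ∀ l, c l = 0) : firstChoiceCount ws c = 0 := by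
  induction ws with
  | nil => rfl
  | cons s ws ih => rw [firstChoiceCount_cons_none (bestAvailable_eq_none.2 h), ih]

open Classical in
/-- Serial dictatorship gives as many first choices as `firstChoiceCount` says. -/
theorem countP_isFirstChoice {n : ℕ} (σ : Fin n → PrefList p) (xs : List (Fin n))
    (hxs : xs.Nodup) (c : Fin p → ℕ) :
    xs.countP (fun i => decide (IsFirstChoice (σ i) (serialDictatorship σ xs c i))) =
      firstChoiceCount (xs.map σ) c := by
  induction xs generalizing c with
  | nil => rfl
  | cons x xs ih =>
    rw [List.nodup_cons] at hxs
    cases hb : bestAvailable c (σ x) with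
    | none =>
      have h := bestAvailable_eq_none.1 hb
      simp [serialDictatorship_of_eq_zero σ _ _ h, firstChoiceCount_of_eq_zero _ h,
        IsFirstChoice]
    | some l =>
      rw [List.map_cons, firstChoiceCount_cons_some hb, ← ih hxs.2,
        countP_serialDictatorship_cons σ hxs.1 hb (fun i o => decide (IsFirstChoice (σ i) o))]
      simp

open Classical in
/-- The candidates of a subset, processed alone with the capacities that they use in the full run,
get the same first choices as in the full run. -/
theorem firstChoiceCount_filter {n : ℕ} (σ : Fin n → PrefList p) (S : Fin n → Bool)
    (xs : List (Fin n)) (hxs : xs.Nodup) (c : Fin p → ℕ) :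
    firstChoiceCount ((xs.filter S).map σ)
        (fun l => xs.countP (fun i => S i && decide (serialDictatorship σ xs c i = some l))) =
      xs.countP (fun i => S i &&
        decide (IsFirstChoice (σ i) (serialDictatorship σ xs c i))) := by
  induction xs generalizing c with
  | nil => simp [firstChoiceCount]
  | cons x xs ih =>
    rw [List.nodup_cons] at hxs
    cases hb : bestAvailable c (σ x) with
    | none =>
      have h := bestAvailable_eq_none.1 hb
      rw [firstChoiceCount_of_eq_zero _ (fun l => by
        simp [serialDictatorship_of_eq_zero σ _ _ h])]
      simp [serialDictatorship_of_eq_zero σ _ _ h, IsFirstChoice]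
    | some l =>
      have hbest := bestAvailable_eq_some.1 hb
      rw [countP_serialDictatorship_cons σ hxs.1 hb
        (fun i o => S i && decide (IsFirstChoice (σ i) o)), ← ih hxs.2]
      have hcount : (fun m => (x :: xs).countP
          (fun i => S i && decide (serialDictatorship σ (x :: xs) c i = some m))) =
          fun m => xs.countP (fun i => S i &&
            decide (serialDictatorship σ xs (Function.update c l (c l - 1)) i = some m)) +
            if S x && decide (some l = some m) then 1 else 0 :=
        funext fun m => countP_serialDictatorship_cons σ hxs.1 hb
          (fun i o => S i && decide (o = some m))
      cases hS : S x with
      | false =>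
        rw [hcount]
        simp [hS]
      | true =>
        -- The slots used by the subset never exceed `c`, so an institution that `x` finds full in
        -- the full run is full here too. The slot of `x` at `l` is counted, hence `x` again chooses
        -- `l`.
        have hle : ∀ m, (x :: xs).countP
            (fun i => S i && decide (serialDictatorship σ (x :: xs) c i = some m)) ≤ c m :=
          fun m => (List.countP_mono_left fun i _ hi => by simp_all).trans
            (countP_serialDictatorship_le σ (x :: xs) (List.nodup_cons.2 hxs) c m)
        have hb' : bestAvailable (fun m => (x :: xs).countP
            (fun i => S i && decide (serialDictatorship σ (x :: xs) c i = some m))) (σ x) =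
            some l := by
          rw [bestAvailable_eq_some]
          refine ⟨?_, fun r hr => ?_⟩
          · rw [congrFun hcount l]
            simp [hS]
          · have := hle (σ x r)
            rw [hbest.2 r hr] at this
            exact Nat.le_zero.1 this
        rw [List.filter_cons_of_pos hS, List.map_cons, firstChoiceCount_cons_some hb', hcount]
        simp only [hS, Bool.true_and, decide_eq_true_eq]
        congr 2
        funext m
        rcases eq_or_ne m l with rfl | hm
        · have := congrFun hcount m
          simp only [hS, Bool.true_and, decide_true, if_true] at this
          simp only [Function.update_self]
          omega
        · simp [Function.update_of_ne hm, hm.symm]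

/-- More capacity never decreases the number of first choices. -/
theorem firstChoiceCount_mono (ws : List (PrefList p)) {c c' : Fin p → ℕ}
    (h : ∀ l, c l ≤ c' l) : firstChoiceCount ws c ≤ firstChoiceCount ws c' := by
  induction ws generalizing c c' with
  | nil => exact le_rfl
  | cons s ws ih =>
    cases hb : bestAvailable c s with
    | none =>
      have h0 := bestAvailable_eq_none.1 hb
      rw [firstChoiceCount_of_eq_zero _ h0]
      exact Nat.zero_le _
    | some l =>
      obtain ⟨hl, hl'⟩ := bestAvailable_eq_some.1 hb
      cases hb' : bestAvailable c' s with
      | none =>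
        have := bestAvailable_eq_none.1 hb' l
        have := h l
        omega
      | some l' =>
        obtain ⟨hm, hm'⟩ := bestAvailable_eq_some.1 hb'
        rw [firstChoiceCount_cons_some hb, firstChoiceCount_cons_some hb']
        -- With more capacity the candidate does at least as well.
        have hle : s.symm l' ≤ s.symm l := by
          by_contra! hlt
          have h1 := hm' _ hlt
          rw [Equiv.apply_symm_apply] at h1
          have := h l
          omega
        refine add_le_add (ih fun m => ?_) ?_
        · rcases eq_or_ne l l' with rfl | hne
          · rcases eq_or_ne m l with rfl | hml
            · simpa using Nat.sub_le_sub_right (h m) 1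
            · simpa [Function.update_of_ne hml] using h m
          -- If the choices differ, `l'` is preferred to `l` and so must be full under `c`. Taking a
          -- slot of `l'` from `c'` therefore cannot break the domination.
          · have h0 : c l' = 0 := by
              have := hl' (s.symm l') (lt_of_le_of_ne hle fun he => hne (s.symm.injective he).symm)
              rwa [Equiv.apply_symm_apply] at this
            rcases eq_or_ne m l' with rfl | hml'
            · simp [Function.update_of_ne hne.symm, h0]
            · rw [Function.update_of_ne hml']
              refine le_trans ?_ (h m)
              rcases eq_or_ne m l with rfl | hml
              · simp
              · simp [Function.update_of_ne hml]
        · by_cases hf : IsFirstChoice s (some l)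
          · obtain ⟨hp, hf'⟩ := hf
            rw [Option.some.injEq] at hf'
            have : l' = l := by
              apply s.symm.injective
              refine le_antisymm hle ?_
              rw [hf', Equiv.symm_apply_apply]
              exact Nat.zero_le _
            rw [this]
          · simp [hf]

/-- Later candidates do not influence earlier ones. -/
theorem firstChoiceCount_le_append (ws vs : List (PrefList p)) (c : Fin p → ℕ) :
    firstChoiceCount ws c ≤ firstChoiceCount (ws ++ vs) c := by
  induction ws generalizing c with
  | nil => exact Nat.zero_le _
  | cons s ws ih =>
    cases hb : bestAvailable c s with
    | none => simpa [firstChoiceCount_cons_none hb] using ih c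
    | some l =>
      rw [List.cons_append, firstChoiceCount_cons_some hb, firstChoiceCount_cons_some hb]
      exact Nat.add_le_add_right (ih _) _

/-- Only as many candidates matter as there are slots. -/
theorem firstChoiceCount_take (ws : List (PrefList p)) (c : Fin p → ℕ) :
    firstChoiceCount (ws.take (∑ l, c l)) c = firstChoiceCount ws c := by
  induction ws generalizing c with
  | nil => simp
  | cons s ws ih =>
    cases hb : bestAvailable c s with
    | none =>
      have h0 := bestAvailable_eq_none.1 hb
      rw [firstChoiceCount_of_eq_zero _ h0, firstChoiceCount_of_eq_zero _ h0]
    | some l =>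
      have hl := (bestAvailable_eq_some.1 hb).1
      rw [← sum_update_pred hl, List.take_succ_cons, firstChoiceCount_cons_some hb,
        firstChoiceCount_cons_some hb, ih]

/-- Until an institution is full, all candidates get their first choice. -/
theorem le_firstChoiceCount (hp : 0 < p) (m : ℕ) (ws : List (PrefList p)) (c : Fin p → ℕ)
    (hc : ∀ l, m ≤ c l) (hm : m ≤ ws.length) : m ≤ firstChoiceCount ws c := by
  induction ws generalizing c m with
  | nil => simp_all
  | cons s ws ih =>
    rcases Nat.eq_zero_or_pos m with rfl | hpos
    · exact Nat.zero_le _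
    have hb : bestAvailable c s = some (s ⟨0, hp⟩) := by
      rw [bestAvailable_eq_some]
      refine ⟨hpos.trans_le (hc _), fun r hr => ?_⟩
      rw [Equiv.symm_apply_apply] at hr
      exact absurd hr (Nat.not_lt_zero _)
    rw [firstChoiceCount_cons_some hb, if_pos ⟨hp, rfl⟩]
    rw [List.length_cons] at hm
    have := ih (m - 1) (Function.update c (s ⟨0, hp⟩) (c (s ⟨0, hp⟩) - 1)) (fun l => by
      rcases eq_or_ne l (s ⟨0, hp⟩) with rfl | hl
      · simpa using Nat.sub_le_sub_right (hc _) 1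
      · rw [Function.update_of_ne hl]
        exact (Nat.sub_le _ _).trans (hc l)) (by omega)
    omega

end FirstChoiceCount

/-! ### Rankings -/

section Ranking

variable {n : ℕ} (v : Fin n → ℝ) (S : Finset (Fin n))

theorem ranking_perm : (ranking v S).Perm (S.sort (fun a b => a ≤ b)) :=
  List.mergeSort_perm _ _

theorem ranking_nodup : (ranking v S).Nodup :=
  (ranking_perm v S).nodup_iff.2 (Finset.sort_nodup _ _)

theorem mem_ranking {i : Fin n} : i ∈ ranking v S ↔ i ∈ S := by
  rw [(ranking_perm v S).mem_iff, Finset.mem_sort]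

theorem length_ranking : (ranking v S).length = S.card := by
  rw [(ranking_perm v S).length_eq, Finset.length_sort]

theorem toFinset_ranking : (ranking v S).toFinset = S := by
  ext i
  rw [List.mem_toFinset, mem_ranking]

theorem ranking_pairwise : (ranking v S).Pairwise (fun a b => v b ≤ v a) := by
  have := List.pairwise_mergeSort (le := fun a b => decide (v b ≤ v a))
    (fun a b c hab hbc => by
      simp only [decide_eq_true_eq] at *
      exact hbc.trans hab)
    (fun a b => by simpa using le_total (v b) (v a)) (S.sort (fun a b => a ≤ b))
  simpa [ranking] using this

/-- The first `m` candidates of the ranking of `S`. -/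
noncomputable def topSet (m : ℕ) : Finset (Fin n) := ((ranking v S).take m).toFinset

theorem mem_topSet {m : ℕ} {i : Fin n} : i ∈ topSet v S m ↔ i ∈ (ranking v S).take m :=
  List.mem_toFinset

theorem topSet_subset (m : ℕ) : topSet v S m ⊆ S := fun _ hi =>
  (mem_ranking v S).1 (List.mem_of_mem_take ((mem_topSet v S).1 hi))

theorem card_topSet {m : ℕ} (hm : m ≤ S.card) : (topSet v S m).card = m := by
  rw [topSet, List.toFinset_card_of_nodup ((ranking_nodup v S).sublist (List.take_sublist _ _)),
    List.length_take, length_ranking, min_eq_left hm]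

theorem le_of_mem_topSet {m : ℕ} {a b : Fin n} (ha : a ∈ S) (ha' : a ∉ topSet v S m)
    (hb : b ∈ topSet v S m) : v a ≤ v b := by
  rw [mem_topSet] at ha' hb
  have h := ranking_pairwise v S
  rw [← List.take_append_drop m (ranking v S), List.pairwise_append] at h
  refine h.2.2 b hb a ?_
  have := (mem_ranking v S).2 ha
  rw [← List.take_append_drop m (ranking v S), List.mem_append] at this
  exact this.resolve_left ha'

end Ranking

theorem optUtility_eq_sum_topSet {n : ℕ} (K : ℕ) (u : Fin n → ℝ) :
    optUtility K u = ∑ i ∈ topSet u Finset.univ K, u i := by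
  rw [optUtility, topSet, List.sum_toFinset _
    ((ranking_nodup u Finset.univ).sublist (List.take_sublist _ _))]

/-! ### The groups -/

section Groups

variable {n p : ℕ} {g : Fin n → Fin 2} {k : Fin p → ℕ}

theorem mem_group {j : Fin 2} {i : Fin n} : i ∈ group g j ↔ g i = j := by
  simp [group]

theorem sum_groups {M : Type*} [AddCommMonoid M] (g : Fin n → Fin 2) (f : Fin n → M) :
    ∑ j, ∑ i ∈ group g j, f i = ∑ i, f i :=
  Finset.sum_fiberwise _ g f

/-- The total capacity reserved for the group `j`. -/
def groupTotal (g : Fin n → Fin 2) (k : Fin p → ℕ) (j : Fin 2) : ℕ := ∑ l, groupCapacity g k j l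

theorem cast_groupCapacity (hk : ∀ (j : Fin 2) (l : Fin p), n ∣ k l * (group g j).card)
    (hn : 0 < n) (j : Fin 2) (l : Fin p) :
    (groupCapacity g k j l : ℝ) = ((group g j).card : ℝ) / n * k l := by
  rw [groupCapacity, Nat.cast_div (hk j l) (by positivity)]
  push_cast
  ring

theorem cast_groupTotal (hk : ∀ (j : Fin 2) (l : Fin p), n ∣ k l * (group g j).card)
    (hn : 0 < n) (j : Fin 2) :
    (groupTotal g k j : ℝ) = ((group g j).card : ℝ) / n * (∑ l, k l : ℕ) := by
  rw [groupTotal]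
  push_cast
  rw [Finset.mul_sum]
  exact Finset.sum_congr rfl fun l _ => cast_groupCapacity hk hn j l

theorem groupTotal_le_card (hk : ∀ (j : Fin 2) (l : Fin p), n ∣ k l * (group g j).card)
    (hn : 0 < n) (hK : ∑ l, k l ≤ n) (j : Fin 2) : groupTotal g k j ≤ (group g j).card := by
  have h := cast_groupTotal hk hn j
  have hn' : (0 : ℝ) < n := by positivity
  have hK' : ((∑ l, k l : ℕ) : ℝ) ≤ n := by exact_mod_cast hK
  have : (groupTotal g k j : ℝ) ≤ (group g j).card := by
    rw [h, div_mul_eq_mul_div, div_le_iff₀ hn']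
    exact mul_le_mul_of_nonneg_left hK' (by positivity)
  exact_mod_cast this

theorem sum_card_group (g : Fin n → Fin 2) : ∑ j, (group g j).card = n := by
  have := sum_groups g (fun _ => 1)
  simpa using this

theorem sum_groupTotal (hk : ∀ (j : Fin 2) (l : Fin p), n ∣ k l * (group g j).card)
    (hn : 0 < n) : ∑ j, groupTotal g k j = ∑ l, k l := by
  have hn' : (n : ℝ) ≠ 0 := by positivity
  have : ((∑ j, groupTotal g k j : ℕ) : ℝ) = ((∑ l, k l : ℕ) : ℝ) := by
    rw [Nat.cast_sum, Finset.sum_congr rfl fun j _ => cast_groupTotal hk hn j, ← Finset.sum_mul,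
      ← Finset.sum_div, ← Nat.cast_sum, sum_card_group, div_self hn', one_mul]
  exact_mod_cast this

theorem isSome_instWise (σ : Fin n → PrefList p) (v : Fin n → ℝ) {i : Fin n} {j : Fin 2}
    (hi : g i = j) :
    (instWise g k σ v i).isSome ↔ i ∈ topSet v (group g j) (groupTotal g k j) := by
  subst hi
  rw [mem_topSet, instWise, stableAssignment, isSome_serialDictatorship, groupTotal]

theorem filter_isSome_instWise (σ : Fin n → PrefList p) (v : Fin n → ℝ) (j : Fin 2) :
    (group g j).filter (fun i => (instWise g k σ v i).isSome) =
      topSet v (group g j) (groupTotal g k j) := by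
  ext i
  rw [Finset.mem_filter]
  constructor
  · rintro ⟨h1, h2⟩
    exact (isSome_instWise σ v (mem_group.1 h1)).1 h2
  · intro h
    have h1 := topSet_subset _ _ _ h
    exact ⟨h1, (isSome_instWise σ v (mem_group.1 h1)).2 h⟩

/-- The slots reserved for a group are no more than its members, so all of them are filled. Their
number is proportional to the size of the group, and that size cancels. -/
theorem selectedFraction_instWise (hk : ∀ (j : Fin 2) (l : Fin p), n ∣ k l * (group g j).card)
    (hn : 0 < n) (hK : ∑ l, k l ≤ n) {j : Fin 2} (hj : 0 < (group g j).card)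
    (σ : Fin n → PrefList p) (v : Fin n → ℝ) :
    selectedFraction g (instWise g k σ v) j = (∑ l, k l : ℕ) / n := by
  rw [selectedFraction, filter_isSome_instWise, card_topSet _ _ (groupTotal_le_card hk hn hK j),
    cast_groupTotal hk hn]
  have : (0 : ℝ) < (group g j).card := by exact_mod_cast hj
  have hn' : (0 : ℝ) < n := by positivity
  field_simp

theorem card_filter_eq_countP {xs : List (Fin n)} (hxs : xs.Nodup) (P : Fin n → Prop)
    [DecidablePred P] :
    (xs.toFinset.filter P).card = xs.countP (fun i => decide (P i)) := by
  rw [List.countP_eq_length_filter, ← List.toFinset_card_of_nodup (hxs.filter _),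
    List.toFinset_filter]
  simp

/-- The fraction depends on the lists only through the word that they form along the ranking. For
fixed utilities this word is i.i.d. -/
theorem firstChoiceFraction_instWise (σ : Fin n → PrefList p) (v : Fin n → ℝ) (j : Fin 2) :
    firstChoiceFraction g σ (instWise g k σ v) j =
      (firstChoiceCount ((ranking v (group g j)).map σ) (groupCapacity g k j) : ℝ) /
        (group g j).card := by
  classical
  rw [firstChoiceFraction, ← countP_isFirstChoice σ _ (ranking_nodup v (group g j)),
    ← card_filter_eq_countP (ranking_nodup v (group g j)), toFinset_ranking]
  congr 3
  ext i
  simp only [Finset.mem_filter, and_congr_right_iff]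
  intro hi
  rw [instWise, mem_group.1 hi]
  rfl

theorem utility_instWise (σ : Fin n → PrefList p) (v u : Fin n → ℝ) :
    utility u (instWise g k σ v) =
      ∑ j, ∑ i ∈ topSet v (group g j) (groupTotal g k j), u i := by
  rw [utility, Finset.sum_filter, ← sum_groups g]
  exact Finset.sum_congr rfl fun j _ => by rw [← Finset.sum_filter, filter_isSome_instWise]

/-- Within a group the bias is a common positive factor, which is why it costs nothing when the
groups are ranked separately. -/
theorem estimated_le_estimated {β : ℝ} (hβ : 0 < β) {u : Fin n → ℝ} {a b : Fin n}
    (hab : g a = g b) : estimated β g u a ≤ estimated β g u b ↔ u a ≤ u b := by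
  unfold estimated
  rw [hab]
  split
  · exact mul_le_mul_iff_right₀ hβ
  · rfl

end Groups

/-! ### The sum of the largest values -/

/-- The smallest value `u b` on `M` is a threshold: it bounds `u` from below on `M` and from above
on `X \ M`. Used both for the optimality of the top `K` and for the share of `T` that a group
collects. -/
theorem min_card_mul_sum_le {ι : Type*} [DecidableEq ι] {G M X : Finset ι} {u : ι → ℝ}
    (hu : ∀ i, 0 ≤ u i) (hX : X ⊆ G) (h : ∀ a ∈ G, a ∉ M → ∀ b ∈ M, u a ≤ u b) :
    (min M.card X.card : ℝ) * ∑ i ∈ X, u i ≤ X.card * ∑ i ∈ M, u i := by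
  rcases M.eq_empty_or_nonempty with rfl | hM
  · simp
  obtain ⟨b, hb, hmin⟩ := Finset.exists_min_image M u hM
  have e1 : ∑ i ∈ X, u i = ∑ i ∈ X ∩ M, u i + ∑ i ∈ X \ M, u i :=
    (Finset.sum_inter_add_sum_sdiff X M u).symm
  have e2 : ∑ i ∈ M, u i = ∑ i ∈ X ∩ M, u i + ∑ i ∈ M \ X, u i := by
    rw [Finset.inter_comm]
    exact (Finset.sum_inter_add_sum_sdiff M X u).symm
  have c1 : (X.card : ℝ) = (X ∩ M).card + (X \ M).card := by
    exact_mod_cast (Finset.card_inter_add_card_sdiff X M).symm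
  have c2 : (M.card : ℝ) = (X ∩ M).card + (M \ X).card := by
    rw [Finset.inter_comm]
    exact_mod_cast (Finset.card_inter_add_card_sdiff M X).symm
  have hA : ((X ∩ M).card : ℝ) * u b ≤ ∑ i ∈ X ∩ M, u i := by
    rw [← nsmul_eq_mul]
    exact Finset.card_nsmul_le_sum _ _ _ fun i hi => hmin i (Finset.mem_inter.1 hi).2
  have hD : ((M \ X).card : ℝ) * u b ≤ ∑ i ∈ M \ X, u i := by
    rw [← nsmul_eq_mul]
    exact Finset.card_nsmul_le_sum _ _ _ fun i hi => hmin i (Finset.mem_sdiff.1 hi).1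
  have hB : ∑ i ∈ X \ M, u i ≤ ((X \ M).card : ℝ) * u b := by
    rw [← nsmul_eq_mul]
    exact Finset.sum_le_card_nsmul _ _ _ fun i hi =>
      h i (hX (Finset.mem_sdiff.1 hi).1) (Finset.mem_sdiff.1 hi).2 b hb
  rw [e1, e2]
  set w : ℝ := min (M.card : ℝ) (X.card : ℝ)
  have hw0 : 0 ≤ w := le_min (by positivity) (by positivity)
  have hwM : w ≤ M.card := min_le_left _ _
  have hwX : w ≤ X.card := min_le_right _ _
  have hθ := hu b
  have hx : (0 : ℝ) ≤ X.card := by positivity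
  have i1 := mul_le_mul_of_nonneg_left hA (sub_nonneg.2 hwX)
  have i2 := mul_le_mul_of_nonneg_left hD hx
  have i3 := mul_le_mul_of_nonneg_left hB hw0
  have i4 := mul_nonneg (mul_nonneg hθ hx) (sub_nonneg.2 hwM)
  -- Once each part is replaced by its size times the threshold, the remaining slack is the
  -- nonnegative quantity of `i4`.
  have i5 : (X.card : ℝ) * ((M \ X).card * u b) + (X.card - w) * ((X ∩ M).card * u b) -
      w * ((X \ M).card * u b) = u b * X.card * (M.card - w) := by
    rw [c2, c1]
    ring
  linarith

theorem sum_le_optUtility {n K : ℕ} (hK : K ≤ n) {u : Fin n → ℝ} (hu : ∀ i, 0 ≤ u i)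
    {A : Finset (Fin n)} (hA : A.card ≤ K) : ∑ i ∈ A, u i ≤ optUtility K u := by
  rw [optUtility_eq_sum_topSet]
  have h := min_card_mul_sum_le hu (Finset.subset_univ A)
    (fun a ha ha' b hb => le_of_mem_topSet (m := K) u Finset.univ ha ha' hb)
  rw [card_topSet _ _ (by simpa using hK), min_eq_right (by exact_mod_cast hA)] at h
  rcases Nat.eq_zero_or_pos A.card with h0 | h0
  · rw [Finset.card_eq_zero.1 h0, Finset.sum_empty]
    exact Finset.sum_nonneg fun i _ => hu i
  · exact le_of_mul_le_mul_left h (by exact_mod_cast h0)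

theorem optUtility_comp_perm {n K : ℕ} (hK : K ≤ n) {u : Fin n → ℝ} (hu : ∀ i, 0 ≤ u i)
    (π : Equiv.Perm (Fin n)) : optUtility K (u ∘ π) = optUtility K u := by
  have key : ∀ (w : Fin n → ℝ) (τ : Equiv.Perm (Fin n)), (∀ i, 0 ≤ w i) →
      optUtility K (w ∘ τ) ≤ optUtility K w := by
    intro w τ hw
    rw [optUtility_eq_sum_topSet K (w ∘ τ)]
    have : ∑ i ∈ topSet (w ∘ τ) Finset.univ K, (w ∘ τ) i =
        ∑ i ∈ (topSet (w ∘ τ) Finset.univ K).map τ.toEmbedding, w i := by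
      rw [Finset.sum_map]
      rfl
    rw [this]
    refine sum_le_optUtility hK hw ?_
    rw [Finset.card_map, card_topSet _ _ (by simpa using hK)]
  refine le_antisymm (key u π hu) ?_
  have := key (u ∘ π) π.symm fun i => hu _
  rwa [Function.comp_assoc, Equiv.self_comp_symm, Function.comp_id] at this

/-! ### Random permutations -/

/-- Sampling without replacement has at most the variance of sampling with replacement. -/
theorem sum_perm_sq_le {n : ℕ} (z : Fin n → ℝ) (hz : ∑ i, z i = 0) (G : Finset (Fin n)) :
    ∑ π : Equiv.Perm (Fin n), (∑ i ∈ G, z (π i)) ^ 2 ≤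
      (Fintype.card (Equiv.Perm (Fin n)) : ℝ) * ∑ i, z i ^ 2 := by
  classical
  set f : Fin n → Fin n → ℝ := fun i j => ∑ π : Equiv.Perm (Fin n), z (π i) * z (π j) with hf
  have hinv : ∀ (τ : Equiv.Perm (Fin n)) (i j : Fin n), f (τ i) (τ j) = f i j := fun τ i j =>
    Fintype.sum_equiv (Equiv.mulRight τ) _ _ fun π => by simp
  have hexp : ∀ A : Finset (Fin n), ∑ π : Equiv.Perm (Fin n), (∑ i ∈ A, z (π i)) ^ 2 =
      ∑ i ∈ A, f i i + ∑ q ∈ A.offDiag, f q.1 q.2 := by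
    intro A
    have : ∑ i ∈ A, f i i = ∑ q ∈ A.diag, f q.1 q.2 := by rw [Finset.sum_diag]
    rw [this, ← Finset.sum_union (Finset.disjoint_diag_offDiag A), Finset.diag_union_offDiag,
      hf, Finset.sum_comm]
    refine Finset.sum_congr rfl fun π _ => ?_
    rw [sq, Finset.sum_mul_sum, ← Finset.sum_product']
  have hdiag : ∀ i, 0 ≤ f i i := fun i => Finset.sum_nonneg fun π _ => mul_self_nonneg _
  have htot : ∀ π : Equiv.Perm (Fin n), ∑ i, z (π i) = 0 := fun π => by
    rw [Equiv.sum_comp π z, hz]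
  -- By symmetry all pairs of distinct positions have the same covariance. The sum over all
  -- positions vanishes for every permutation, so this common value must compensate the nonnegative
  -- diagonal.
  have hneg : ∀ i j, i ≠ j → f i j ≤ 0 := by
    intro i j hij
    have h := hexp Finset.univ
    simp only [htot, ne_eq, OfNat.ofNat_ne_zero, not_false_eq_true, zero_pow,
      Finset.sum_const_zero] at h
    have hconst : ∀ q ∈ (Finset.univ : Finset (Fin n)).offDiag, f q.1 q.2 = f i j := by
      rintro ⟨a, b⟩ hq
      have hab : a ≠ b := (Finset.mem_offDiag.1 hq).2.2
      -- The first swap moves `i` to `a`; the second moves the image of `j` to `b` and leaves `a`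
      -- alone.
      have h1 : Equiv.swap (Equiv.swap i a j) b (Equiv.swap i a i) = a := by
        rw [Equiv.swap_apply_left, Equiv.swap_apply_of_ne_of_ne _ hab]
        intro he
        exact hij ((Equiv.swap i a).injective ((Equiv.swap_apply_left i a).trans he))
      have := hinv (Equiv.swap (Equiv.swap i a j) b * Equiv.swap i a) i j
      rwa [Equiv.Perm.mul_apply, Equiv.Perm.mul_apply, h1, Equiv.swap_apply_left] at this
    rw [Finset.sum_congr rfl hconst, Finset.sum_const, nsmul_eq_mul] at h
    have hcard : (0 : ℝ) < (Finset.univ : Finset (Fin n)).offDiag.card := by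
      exact_mod_cast Finset.card_pos.2 ⟨(i, j), by simp [hij]⟩
    have hd := Finset.sum_nonneg fun i (_ : i ∈ Finset.univ) => hdiag i
    by_contra! hpos
    have := mul_pos hcard hpos
    linarith
  rw [hexp]
  have h1 : ∑ q ∈ G.offDiag, f q.1 q.2 ≤ 0 :=
    Finset.sum_nonpos fun q hq => hneg _ _ (Finset.mem_offDiag.1 hq).2.2
  have h2 : ∑ i ∈ G, f i i ≤ ∑ i, f i i :=
    Finset.sum_le_sum_of_subset_of_nonneg (Finset.subset_univ G) fun i _ _ => hdiag i
  have h3 : ∑ i, f i i = (Fintype.card (Equiv.Perm (Fin n)) : ℝ) * ∑ i, z i ^ 2 := by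
    rw [hf, Finset.sum_comm, ← nsmul_eq_mul, ← Finset.card_univ, ← Finset.sum_const]
    refine Finset.sum_congr rfl fun π _ => ?_
    rw [← Equiv.sum_comp π (fun i => z i ^ 2)]
    exact Finset.sum_congr rfl fun i _ => (sq _).symm
  linarith

/-! ### Utility of the institution-wise algorithm -/

section Utility

variable {n p : ℕ} {g : Fin n → Fin 2} {k : Fin p → ℕ}

theorem utility_instWise_le_optUtility
    (hk : ∀ (j : Fin 2) (l : Fin p), n ∣ k l * (group g j).card) (hn : 0 < n)
    (hK : ∑ l, k l ≤ n) (σ : Fin n → PrefList p) (v : Fin n → ℝ) {u : Fin n → ℝ}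
    (hu : ∀ i, 0 ≤ u i) : utility u (instWise g k σ v) ≤ optUtility (∑ l, k l) u := by
  refine sum_le_optUtility hK hu (le_of_eq ?_)
  rw [Finset.card_filter, ← sum_groups g, ← sum_groupTotal hk hn]
  refine Finset.sum_congr rfl fun j _ => ?_
  rw [← Finset.card_filter, filter_isSome_instWise,
    card_topSet _ _ (groupTotal_le_card hk hn hK j)]

theorem utilityQuotient_instWise_mem_Icc
    (hk : ∀ (j : Fin 2) (l : Fin p), n ∣ k l * (group g j).card) (hn : 0 < n)
    (hK : ∑ l, k l ≤ n) (σ : Fin n → PrefList p) (v : Fin n → ℝ) {u : Fin n → ℝ}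
    (hu : ∀ i, 0 ≤ u i) :
    utilityQuotient (∑ l, k l) u (instWise g k σ v) ∈ Set.Icc (0 : ℝ) 1 := by
  have h := utility_instWise_le_optUtility hk hn hK σ v hu
  have h0 : 0 ≤ utility u (instWise g k σ v) := Finset.sum_nonneg fun i _ => hu i
  unfold utilityQuotient
  split_ifs
  · simp
  · exact ⟨div_nonneg h0 (h0.trans h), div_le_one_of_le₀ h (h0.trans h)⟩

/-- When the values are permuted by `π`, the share `min (1, c / x)` of the `x` candidates of group
`j` with a value in `T` that fits into `c` slots. -/
noncomputable def groupWeight (g : Fin n → Fin 2) (T : Finset (Fin n)) (c : ℕ) (j : Fin 2)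
    (π : Equiv.Perm (Fin n)) : ℝ :=
  min (c : ℝ) ((group g j).filter (fun i => π i ∈ T)).card /
    ((group g j).filter (fun i => π i ∈ T)).card

/-- Exchanging two values inside `T` does not change which candidates hold a value of `T`. -/
theorem groupWeight_swap_mul (T : Finset (Fin n)) (c : ℕ) (j : Fin 2) (π : Equiv.Perm (Fin n))
    {s t : Fin n} (hs : s ∈ T) (ht : t ∈ T) :
    groupWeight g T c j (Equiv.swap s t * π) = groupWeight g T c j π := by
  have : ∀ i, (Equiv.swap s t * π) i ∈ T ↔ π i ∈ T := by
    intro i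
    rw [Equiv.Perm.mul_apply, Equiv.swap_apply_def]
    split_ifs with h1 h2
    · simp [h1, hs, ht]
    · simp [h2, hs, ht]
    · rfl
  simp only [groupWeight, this]

theorem groupWeight_mul_card (T : Finset (Fin n)) (c : ℕ) (j : Fin 2)
    (π : Equiv.Perm (Fin n)) :
    groupWeight g T c j π * ((group g j).filter (fun i => π i ∈ T)).card =
      min (c : ℝ) ((group g j).filter (fun i => π i ∈ T)).card := by
  rw [groupWeight]
  rcases eq_or_ne (((group g j).filter (fun i => π i ∈ T)).card : ℝ) 0 with h | h
  · rw [h]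
    simp
  · rw [div_mul_cancel₀ _ h]

/-- Averaged over all permutations, every element of `T` has the same weight. -/
theorem sum_perm_groupWeight (T : Finset (Fin n)) (c : ℕ) (j : Fin 2) (w : Fin n → ℝ) :
    (T.card : ℝ) * ∑ π : Equiv.Perm (Fin n), groupWeight g T c j π *
        ∑ i ∈ (group g j).filter (fun i => π i ∈ T), w (π i) =
      (∑ t ∈ T, w t) * ∑ π : Equiv.Perm (Fin n),
        min (c : ℝ) ((group g j).filter (fun i => π i ∈ T)).card := by
  -- `W t` is the total weight collected by the value `t`, over the permutations that give it to a
  -- member of group `j`. It is constant on `T`, and the choice `x = 1` in `hsum` identifies its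
  -- sum.
  set W : Fin n → ℝ := fun t => ∑ π : Equiv.Perm (Fin n),
    if g (π.symm t) = j then groupWeight g T c j π else 0 with hW
  have hsum : ∀ x : Fin n → ℝ, ∑ π : Equiv.Perm (Fin n), groupWeight g T c j π *
      ∑ i ∈ (group g j).filter (fun i => π i ∈ T), x (π i) = ∑ t ∈ T, x t * W t := by
    intro x
    rw [hW]
    simp_rw [Finset.mul_sum]
    rw [Finset.sum_comm]
    refine Finset.sum_congr rfl fun π _ => ?_
    rw [group, Finset.filter_filter, Finset.sum_filter]
    have : ∀ t, x t * (if g (π.symm t) = j then groupWeight g T c j π else 0) =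
        if g (π.symm t) = j then groupWeight g T c j π * x t else 0 := by
      intro t
      split_ifs
      · ring
      · simp
    simp_rw [this]
    have hT : ∀ F : Fin n → ℝ, ∑ t ∈ T, F t = ∑ i, if π i ∈ T then F (π i) else 0 := fun F => by
      rw [Equiv.sum_comp π (fun t => if t ∈ T then F t else 0), Finset.sum_ite_mem,
        Finset.univ_inter]
    rw [hT]
    refine Finset.sum_congr rfl fun i _ => ?_
    rw [Equiv.symm_apply_apply]
    split_ifs <;> simp_all
  have hconst : ∀ s ∈ T, ∀ t ∈ T, W s = W t := by
    intro s hs t ht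
    rw [hW]
    refine Fintype.sum_equiv (Equiv.mulLeft (Equiv.swap s t)) _ _ fun π => ?_
    rw [Equiv.coe_mulLeft, groupWeight_swap_mul T c j π hs ht]
    have : (Equiv.swap s t * π).symm t = π.symm s := by
      change π.symm ((Equiv.swap s t).symm t) = _
      rw [Equiv.symm_swap, Equiv.swap_apply_right]
    rw [this]
  have hone : ∑ t ∈ T, W t = ∑ π : Equiv.Perm (Fin n),
      min (c : ℝ) ((group g j).filter (fun i => π i ∈ T)).card := by
    have := hsum fun _ => 1
    simp only [one_mul, Finset.sum_const, nsmul_eq_mul, mul_one, groupWeight_mul_card] at this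
    exact this.symm
  rw [hsum w, ← hone]
  rcases T.eq_empty_or_nonempty with rfl | ⟨s, hs⟩
  · simp
  rw [Finset.sum_congr rfl fun t ht => by rw [hconst t ht s hs],
    Finset.sum_congr rfl fun t ht => hconst t ht s hs, ← Finset.sum_mul, Finset.sum_const,
    nsmul_eq_mul]
  ring

/-- By Cauchy–Schwarz the first absolute moment is controlled by the second. The latter is bounded
by `sum_perm_sq_le` for the centred indicator `z` of `T`, whose squares sum to at most `T.card`. -/
theorem sum_perm_abs_card_sub_le {T : Finset (Fin n)} (hn : 0 < n) (G : Finset (Fin n)) :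
    ∑ π : Equiv.Perm (Fin n), |((G.filter (fun i => π i ∈ T)).card : ℝ) - G.card / n * T.card| ≤
      Fintype.card (Equiv.Perm (Fin n)) * √(T.card : ℝ) := by
  set z : Fin n → ℝ := fun t => (if t ∈ T then 1 else 0) - T.card / n with hz
  have hn' : (0 : ℝ) < n := by positivity
  have hcard : ∑ t, (if t ∈ T then (1 : ℝ) else 0) = T.card := by simp
  have hsum : ∑ t, z t = 0 := by
    rw [hz, Finset.sum_sub_distrib, hcard, Finset.sum_const, Finset.card_univ, Fintype.card_fin,
      nsmul_eq_mul]
    field_simp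
    ring
  have hsq : ∑ t, z t ^ 2 ≤ T.card := by
    have h1 : ∀ t, z t ^ 2 =
        (1 - T.card / n) * (if t ∈ T then (1 : ℝ) else 0) - T.card / n * z t := by
      intro t
      simp only [hz]
      split_ifs <;> ring
    rw [Finset.sum_congr rfl fun t _ => h1 t, Finset.sum_sub_distrib, ← Finset.mul_sum,
      ← Finset.mul_sum, hcard, hsum]
    have : (0 : ℝ) ≤ T.card / n * T.card := by positivity
    linarith
  have hdiff : ∀ π : Equiv.Perm (Fin n),
      ((G.filter (fun i => π i ∈ T)).card : ℝ) - G.card / n * T.card = ∑ i ∈ G, z (π i) := by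
    intro π
    simp only [hz]
    rw [Finset.sum_sub_distrib, Finset.sum_const, nsmul_eq_mul, Finset.sum_boole]
    ring
  simp_rw [hdiff]
  refine (sq_le_sq₀ (by positivity) (by positivity)).1 ?_
  rw [mul_pow, Real.sq_sqrt (by positivity)]
  calc (∑ π : Equiv.Perm (Fin n), |∑ i ∈ G, z (π i)|) ^ 2
      ≤ Fintype.card (Equiv.Perm (Fin n)) *
        ∑ π : Equiv.Perm (Fin n), |∑ i ∈ G, z (π i)| ^ 2 := sq_sum_le_card_mul_sum_sq
    _ ≤ Fintype.card (Equiv.Perm (Fin n)) *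
        (Fintype.card (Equiv.Perm (Fin n)) * T.card) := by
        simp_rw [sq_abs]
        gcongr
        exact (sum_perm_sq_le z hsum G).trans (by gcongr)
    _ = _ := by ring

/-- For a fixed multiset of utilities, distributed at random among the candidates, the expected
utility quotient is at least `1 - 1 / √K`. -/
theorem le_sum_perm_utilityQuotient
    (hk : ∀ (j : Fin 2) (l : Fin p), n ∣ k l * (group g j).card) (hn : 0 < n)
    (hK : ∑ l, k l ≤ n) (hK0 : 0 < ∑ l, k l) {β : ℝ} (hβ : 0 < β) (σ : Fin n → PrefList p)
    {u : Fin n → ℝ} (hu : ∀ i, 0 ≤ u i) :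
    Fintype.card (Equiv.Perm (Fin n)) * (1 - 1 / √((∑ l, k l : ℕ) : ℝ)) ≤
      ∑ π : Equiv.Perm (Fin n), utilityQuotient (∑ l, k l) (u ∘ π)
        (instWise g k σ (estimated β g (u ∘ π))) := by
  set K := ∑ l, k l with hKdef
  have hKr : (0 : ℝ) < K := by exact_mod_cast hK0
  simp only [utilityQuotient, optUtility_comp_perm hK hu]
  split_ifs with h0
  · rw [Finset.sum_const, Finset.card_univ, nsmul_eq_mul]
    gcongr
    linarith [show (0 : ℝ) ≤ 1 / √(K : ℝ) by positivity]
  have hopt : 0 < optUtility K u := by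
    refine lt_of_le_of_ne ?_ (Ne.symm h0)
    rw [optUtility_eq_sum_topSet]
    exact Finset.sum_nonneg fun i _ => hu i
  set T := topSet u Finset.univ K with hT
  have hTc : T.card = K := card_topSet _ _ (by simpa using hK)
  rw [← Finset.sum_div, le_div_iff₀ hopt]
  -- For each permutation, the top part of a group is compared with its candidates holding a value
  -- in `T`.
  have hpath : ∀ π : Equiv.Perm (Fin n),
      ∑ j, groupWeight g T (groupTotal g k j) j π *
        ∑ i ∈ (group g j).filter (fun i => π i ∈ T), u (π i) ≤
      utility (u ∘ π) (instWise g k σ (estimated β g (u ∘ π))) := by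
    intro π
    rw [utility_instWise]
    refine Finset.sum_le_sum fun j _ => ?_
    set M := topSet (estimated β g (u ∘ π)) (group g j) (groupTotal g k j) with hM
    have hMc : M.card = groupTotal g k j := card_topSet _ _ (groupTotal_le_card hk hn hK j)
    have h := min_card_mul_sum_le (G := group g j) (M := M)
      (X := (group g j).filter (fun i => π i ∈ T)) (u := u ∘ π) (fun i => hu _)
      (Finset.filter_subset _ _) (fun a ha ha' b hb => by
        have hab : g a = g b :=
          (mem_group.1 ha).trans (mem_group.1 (topSet_subset _ _ _ hb)).symm
        exact (estimated_le_estimated hβ hab).1 (le_of_mem_topSet _ _ ha ha' hb))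
    rw [groupWeight]
    rcases Nat.eq_zero_or_pos ((group g j).filter (fun i => π i ∈ T)).card with hx | hx
    · rw [hx, Nat.cast_zero, div_zero, zero_mul]
      exact Finset.sum_nonneg fun i _ => hu _
    · have hx' : (0 : ℝ) < ((group g j).filter (fun i => π i ∈ T)).card := by exact_mod_cast hx
      rw [div_mul_eq_mul_div, div_le_iff₀ hx', ← hMc, mul_comm (∑ i ∈ M, _)]
      exact h
  -- Over the two groups both the slots and the values of `T` add up to `K`, so the excess in one
  -- group is the deficit in the other and one absolute value measures the whole loss.
  have hmin : ∀ π : Equiv.Perm (Fin n), (K : ℝ) -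
      |(((group g 0).filter (fun i => π i ∈ T)).card : ℝ) - (group g 0).card / n * T.card| ≤
      ∑ j, min (groupTotal g k j : ℝ) ((group g j).filter (fun i => π i ∈ T)).card := by
    intro π
    have h1 : ∑ j, (((group g j).filter (fun i => π i ∈ T)).card : ℝ) = K := by
      rw [← hTc]
      simp_rw [Finset.card_filter]
      rw [← Nat.cast_sum, sum_groups g (fun i => if π i ∈ T then 1 else 0),
        Equiv.sum_comp π (fun i => if i ∈ T then 1 else 0)]
      simp
    have h2 : ∑ j, (groupTotal g k j : ℝ) = K := by
      exact_mod_cast sum_groupTotal hk hn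
    rw [hTc, ← cast_groupTotal hk hn 0]
    rw [Fin.sum_univ_two] at h1 h2 ⊢
    rcases abs_cases ((((group g 0).filter (fun i => π i ∈ T)).card : ℝ) - groupTotal g k 0)
      with ⟨h, h'⟩ | ⟨h, h'⟩
    · rw [h, min_eq_left (by linarith), min_eq_right (by linarith)]
      linarith
    · rw [h, min_eq_right (by linarith), min_eq_left (by linarith)]
      linarith
  have habs := sum_perm_abs_card_sub_le (T := T) hn (group g 0)
  have hsqrt : √(K : ℝ) * √(K : ℝ) = K := Real.mul_self_sqrt hKr.le
  have hsqrt0 : 0 < √(K : ℝ) := Real.sqrt_pos.2 hKr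
  refine le_of_mul_le_mul_left (a := (K : ℝ)) ?_ hKr
  calc (K : ℝ) * (Fintype.card (Equiv.Perm (Fin n)) * (1 - 1 / √(K : ℝ)) * optUtility K u)
      = optUtility K u * (Fintype.card (Equiv.Perm (Fin n)) * K -
          Fintype.card (Equiv.Perm (Fin n)) * √(T.card : ℝ)) := by
        rw [hTc]
        have : (K : ℝ) * (1 / √(K : ℝ)) = √(K : ℝ) := by
          rw [mul_one_div, div_eq_iff hsqrt0.ne', hsqrt]
        linear_combination (-(Fintype.card (Equiv.Perm (Fin n)) : ℝ) * optUtility K u) * this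
    _ ≤ optUtility K u * ∑ π : Equiv.Perm (Fin n), ∑ j,
          min (groupTotal g k j : ℝ) ((group g j).filter (fun i => π i ∈ T)).card := by
        refine mul_le_mul_of_nonneg_left ?_ hopt.le
        refine le_trans ?_ (Finset.sum_le_sum fun π _ => hmin π)
        rw [Finset.sum_sub_distrib, Finset.sum_const, Finset.card_univ, nsmul_eq_mul]
        linarith
    _ = K * ∑ π : Equiv.Perm (Fin n), ∑ j, groupWeight g T (groupTotal g k j) j π *
          ∑ i ∈ (group g j).filter (fun i => π i ∈ T), u (π i) := by
        rw [Finset.sum_comm, Finset.mul_sum, Finset.sum_comm (s := Finset.univ (α := Equiv.Perm _)),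
          Finset.mul_sum]
        refine Finset.sum_congr rfl fun j _ => ?_
        have hq := sum_perm_groupWeight T (groupTotal g k j) j u (g := g)
        rw [hTc] at hq
        rw [hq, optUtility_eq_sum_topSet]
    _ ≤ _ := mul_le_mul_of_nonneg_left (Finset.sum_le_sum fun π _ => hpath π) hKr.le

end Utility

/-! ### Product measures -/

/-- Independent samples along an injective reindexing are independent samples. -/
theorem map_pi_precomp {ι κ α : Type*} [Fintype ι] [Fintype κ] [MeasurableSpace α]
    (μ : Measure α) [IsProbabilityMeasure μ] {e : κ → ι} (he : e.Injective) :
    (Measure.pi (fun _ : ι => μ)).map (fun x i => x (e i)) = Measure.pi (fun _ : κ => μ) := by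
  have h := (ProbabilityTheory.iIndepFun_pi (μ := fun _ : ι => μ) (X := fun _ => id)
    (fun _ => aemeasurable_id)).precomp he
  have h' := h.map_fun_eq_pi_map (fun i => (measurable_pi_apply (e i)).aemeasurable)
  refine h'.trans ?_
  congr 1
  funext i
  exact (measurePreserving_eval (fun _ : ι => μ) (e i)).map_eq

instance {p : ℕ} : DiscreteMeasurableSpace (PrefList p) := ⟨fun _ => trivial⟩

/-- The probability of an event about the preference lists of distinct candidates depends only on
the number of these candidates. -/
theorem pi_setOf_map_eq {n N p : ℕ} (L : Measure (PrefList p)) [IsProbabilityMeasure L]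
    {a : List (Fin n)} {b : List (Fin N)} (ha : a.Nodup) (hb : b.Nodup)
    (hab : a.length = b.length) (Q : List (PrefList p) → Prop) :
    Measure.pi (fun _ : Fin n => L) {σ | Q (a.map σ)} =
      Measure.pi (fun _ : Fin N => L) {σ | Q (b.map σ)} := by
  have key : ∀ {m : ℕ} (x : List (Fin m)), x.Nodup →
      Measure.pi (fun _ : Fin m => L) {σ | Q (x.map σ)} =
        Measure.pi (fun _ : Fin x.length => L) {τ | Q (List.ofFn τ)} := by
    intro m x hx
    rw [← map_pi_precomp L (List.nodup_iff_injective_get.1 hx),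
      Measure.map_apply (measurable_pi_lambda _ fun i => measurable_pi_apply _)
        MeasurableSet.of_discrete]
    congr 1
    ext σ
    have : List.ofFn (fun i => σ (x.get i)) = x.map σ := by
      rw [← Function.comp_def, ← List.map_ofFn, List.ofFn_get]
    simp only [Set.mem_ofPred_eq, Set.mem_preimage, this]
  rw [key a ha, key b hb, hab]

open ProbabilityTheory in
/-- **Hoeffding inequality** for the empirical mean over the coordinates in `A`. -/
theorem pi_real_sum_sub_ge_le {ι α : Type*} [Fintype ι] [MeasurableSpace α] (μ : Measure α)
    [IsProbabilityMeasure μ] {f : α → ℝ} (hf : Measurable f) {a : ℝ}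
    (hfa : ∀ x, f x ∈ Set.Icc a (a + 1)) (A : Finset ι) {r : ℝ} (hr : 0 ≤ r) :
    (Measure.pi (fun _ : ι => μ)).real {x | r * A.card ≤ ∑ i ∈ A, (f (x i) - ∫ y, f y ∂μ)} ≤
      Real.exp (-(2 * r ^ 2 * A.card)) := by
  have hind := iIndepFun_pi (μ := fun _ : ι => μ) (X := fun _ y => f y - ∫ y, f y ∂μ)
    (fun _ => (hf.sub_const _).aemeasurable)
  have hsub : ∀ i ∈ A, HasSubgaussianMGF (fun x : ι → α => f (x i) - ∫ y, f y ∂μ)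
      ((‖(a + 1) - a‖₊ / 2) ^ 2) (Measure.pi (fun _ : ι => μ)) := by
    intro i _
    have h := hasSubgaussianMGF_of_mem_Icc (μ := Measure.pi (fun _ : ι => μ))
      (X := fun x => f (x i)) (a := a) (b := a + 1)
      (hf.comp (measurable_pi_apply i)).aemeasurable (Filter.Eventually.of_forall fun x => hfa _)
    have he := integral_map (μ := Measure.pi (fun _ : ι => μ)) (φ := Function.eval i)
      (measurable_pi_apply i).aemeasurable (f := f) hf.aestronglyMeasurable
    rw [(measurePreserving_eval (fun _ : ι => μ) i).map_eq] at he
    rw [he]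
    exact h
  refine (HasSubgaussianMGF.measure_sum_ge_le_of_iIndepFun hind hsub
    (ε := r * A.card) (by positivity)).trans (le_of_eq ?_)
  congr 1
  rw [add_sub_cancel_left, nnnorm_one, Finset.sum_const]
  push_cast
  rcases eq_or_ne (A.card : ℝ) 0 with h | h
  · simp [h]
  · rw [nsmul_eq_mul]
    field_simp

/-! ### Labels -/

/-- A random label: `1` with probability `a`, `2` with probability `b`, and otherwise `0`. -/
noncomputable def labelLaw (a b : ℝ) : Measure (Fin 3) :=
  ENNReal.ofReal a • Measure.dirac 1 + ENNReal.ofReal b • Measure.dirac 2 +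
    ENNReal.ofReal (1 - a - b) • Measure.dirac 0

theorem isProbabilityMeasure_labelLaw {a b : ℝ} (ha : 0 ≤ a) (hb : 0 ≤ b) (hab : a + b ≤ 1) :
    IsProbabilityMeasure (labelLaw a b) := by
  constructor
  simp only [labelLaw, Measure.add_apply, Measure.smul_apply, measure_univ, smul_eq_mul, mul_one]
  rw [← ENNReal.ofReal_add ha hb, ← ENNReal.ofReal_add (by positivity) (by linarith)]
  simp

theorem integral_labelLaw {a b : ℝ} (ha : 0 ≤ a) (hb : 0 ≤ b) (hab : a + b ≤ 1)
    (f : Fin 3 → ℝ) :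
    ∫ x, f x ∂(labelLaw a b) = a * f 1 + b * f 2 + (1 - a - b) * f 0 := by
  have hi : ∀ (μ : Measure (Fin 3)) [IsFiniteMeasure μ], Integrable f μ :=
    fun μ _ => Integrable.of_finite
  have hd : ∀ (c : ℝ) (x : Fin 3), Integrable f (ENNReal.ofReal c • Measure.dirac x) :=
    fun c x => (hi _).smul_measure ENNReal.ofReal_ne_top
  rw [labelLaw, integral_add_measure ((hd a 1).add_measure (hd b 2)) (hd _ 0),
    integral_add_measure (hd a 1) (hd b 2)]
  simp only [integral_smul_measure, integral_dirac, smul_eq_mul]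
  rw [ENNReal.toReal_ofReal ha, ENNReal.toReal_ofReal hb, ENNReal.toReal_ofReal (by linarith)]

/-- The number of elements of `A` with the label `h`, as a sum. -/
theorem sum_label_eq_card {ι : Type*} (A : Finset ι) (x : ι → Fin 3) (h : Fin 3) :
    ∑ i ∈ A, (if x i = h then (1 : ℝ) else 0) = (A.filter (fun i => x i = h)).card := by
  rw [Finset.sum_boole]

theorem pi_real_label_ge_le {ι : Type*} [Fintype ι] (μ : Measure (Fin 3))
    [IsProbabilityMeasure μ] (h : Fin 3) (A : Finset ι) {r : ℝ} (hr : 0 ≤ r) :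
    (Measure.pi (fun _ : ι => μ)).real
        {x | (∫ y, (if y = h then (1 : ℝ) else 0) ∂μ + r) * A.card ≤
          (A.filter (fun i => x i = h)).card} ≤
      Real.exp (-(2 * r ^ 2 * A.card)) := by
  refine le_trans (le_of_eq ?_) (pi_real_sum_sub_ge_le μ
    (f := fun y => if y = h then (1 : ℝ) else 0) (Measurable.of_discrete) (a := 0)
    (fun y => by split_ifs <;> simp) A hr)
  congr 1
  ext x
  simp only [Set.mem_ofPred_eq]
  rw [Finset.sum_sub_distrib, sum_label_eq_card, Finset.sum_const, nsmul_eq_mul]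
  constructor <;> intro hx <;> linarith

theorem pi_real_label_le_le {ι : Type*} [Fintype ι] (μ : Measure (Fin 3))
    [IsProbabilityMeasure μ] (h : Fin 3) (A : Finset ι) {r : ℝ} (hr : 0 ≤ r) :
    (Measure.pi (fun _ : ι => μ)).real
        {x | ((A.filter (fun i => x i = h)).card : ℝ) ≤
          (∫ y, (if y = h then (1 : ℝ) else 0) ∂μ - r) * A.card} ≤
      Real.exp (-(2 * r ^ 2 * A.card)) := by
  refine le_trans (le_of_eq ?_) (pi_real_sum_sub_ge_le μ
    (f := fun y => -(if y = h then (1 : ℝ) else 0)) (Measurable.of_discrete) (a := -1)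
    (fun y => by split_ifs <;> simp) A hr)
  congr 1
  ext x
  simp only [Set.mem_ofPred_eq]
  rw [Finset.sum_sub_distrib, Finset.sum_neg_distrib, sum_label_eq_card, Finset.sum_const,
    nsmul_eq_mul, integral_neg]
  constructor <;> intro hx <;> linarith

/-! ### Comparison of the two groups -/

section Comparison

variable {n p : ℕ}

open Classical in
/-- The candidates that get their first choice in the run on all candidates. -/
noncomputable def firstChoiceSet {N p : ℕ} (W : Fin N → PrefList p) (c : Fin p → ℕ) :
    Finset (Fin N) :=
  Finset.univ.filter fun i =>
    IsFirstChoice (W i) (serialDictatorship W (List.finRange N) c i)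

/-- The candidates that are assigned to `l` in the run on all candidates. -/
noncomputable def assignedSet {N p : ℕ} (W : Fin N → PrefList p) (c : Fin p → ℕ) (l : Fin p) :
    Finset (Fin N) :=
  Finset.univ.filter fun i => serialDictatorship W (List.finRange N) c i = some l

theorem card_filter_univ_eq_countP {N : ℕ} (P : Fin N → Prop) [DecidablePred P] :
    (Finset.univ.filter P).card = (List.finRange N).countP (fun i => decide (P i)) := by
  rw [← card_filter_eq_countP (List.nodup_finRange N)]
  congr
  ext i
  simp

theorem card_assignedSet {N : ℕ} (W : Fin N → PrefList p) (c : Fin p → ℕ)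
    (hc : ∑ l, c l ≤ N) (l : Fin p) : (assignedSet W c l).card = c l := by
  rw [assignedSet, card_filter_univ_eq_countP,
    countP_serialDictatorship_eq W _ (List.nodup_finRange N) c (by simpa using hc)]

/-- Makes the set of first choices large enough for Hoeffding's inequality to be useful on it. -/
theorem le_card_firstChoiceSet {N : ℕ} (hp : 0 < p) (W : Fin N → PrefList p) (c : Fin p → ℕ)
    {m : ℕ} (hm : m ≤ N) (hc : ∀ l, m ≤ c l) : m ≤ (firstChoiceSet W c).card := by
  classical
  rw [firstChoiceSet, card_filter_univ_eq_countP,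
    countP_isFirstChoice W _ (List.nodup_finRange N)]
  exact le_firstChoiceCount hp m _ c hc (by simpa using hm)

/-- The candidates with label `h`, in increasing order. -/
def labelled {N : ℕ} (x : Fin N → Fin 3) (h : Fin 3) : List (Fin N) :=
  (List.finRange N).filter (fun i => decide (x i = h))

theorem nodup_labelled {N : ℕ} (x : Fin N → Fin 3) (h : Fin 3) : (labelled x h).Nodup :=
  (List.nodup_finRange N).filter _

theorem labelled_disjoint {N : ℕ} (x : Fin N → Fin 3) {h h' : Fin 3} (hh : h ≠ h') :
    (labelled x h).Disjoint (labelled x h') := by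
  intro i hi hi'
  rw [labelled, List.mem_filter, decide_eq_true_eq] at hi hi'
  exact hh (hi.2.symm.trans hi'.2)

/-- The label classes inherit their first choices exactly, at the random capacities that they use in
the full run; monotonicity later replaces these by fixed ones. -/
theorem firstChoiceCount_labelled {N : ℕ} (W : Fin N → PrefList p) (c : Fin p → ℕ)
    (x : Fin N → Fin 3) (h : Fin 3) :
    firstChoiceCount ((labelled x h).map W)
        (fun l => ((assignedSet W c l).filter (fun i => x i = h)).card) =
      ((firstChoiceSet W c).filter (fun i => x i = h)).card := by
  classical
  have h1 := firstChoiceCount_filter W (fun i => decide (x i = h)) (List.finRange N)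
    (List.nodup_finRange N) c
  rw [firstChoiceSet, Finset.filter_filter, card_filter_univ_eq_countP, labelled]
  refine Eq.trans ?_ (h1.trans ?_)
  · congr 1
    funext l
    rw [assignedSet, Finset.filter_filter, card_filter_univ_eq_countP]
    refine List.countP_congr fun i _ => ?_
    simp [and_comm]
  · refine List.countP_congr fun i _ => ?_
    simp [and_comm]

/-- When the total capacity is exactly `N` everybody is assigned, so the institutions partition each
label class. -/
theorem length_labelled {N : ℕ} (W : Fin N → PrefList p) (c : Fin p → ℕ) (hc : ∑ l, c l = N)
    (x : Fin N → Fin 3) (h : Fin 3) :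
    (labelled x h).length = ∑ l, ((assignedSet W c l).filter (fun i => x i = h)).card := by
  have hsome : ∀ i, (serialDictatorship W (List.finRange N) c i).isSome := fun i => by
    rw [isSome_serialDictatorship, hc, List.take_of_length_le (by simp)]
    simp
  rw [labelled, ← List.countP_eq_length_filter, ← card_filter_univ_eq_countP,
    Finset.card_eq_sum_card_fiberwise (t := Finset.univ.map Function.Embedding.some)
      (f := fun i => serialDictatorship W (List.finRange N) c i), Finset.sum_map]
  · refine Finset.sum_congr rfl fun l _ => ?_
    rw [assignedSet, Finset.filter_filter, Finset.filter_filter]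
    congr 1
    ext i
    simp [and_comm]
  · intro i _
    obtain ⟨l, hl⟩ := Option.isSome_iff_exists.1 (hsome i)
    simp [hl]

end Comparison

/-! ### Random splitting of the run with doubled capacities -/

section Comparison

variable {n N p : ℕ}

/-- The labels `x` split every institution and the set of first choices of the run with
capacities `2 * k` nearly in the proportions `s₁` and `s₂`. -/
structure IsBalanced (W : Fin N → PrefList p) (k c₁ c₂ : Fin p → ℕ) (s₁ s₂ ε : ℝ)
    (x : Fin N → Fin 3) : Prop where
  le_one : ∀ l, (c₁ l : ℝ) ≤ ((assignedSet W (2 * k) l).filter (fun i => x i = 1)).card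
  two_le : ∀ l, (((assignedSet W (2 * k) l).filter (fun i => x i = 2)).card : ℝ) ≤ c₂ l
  first_le : (((firstChoiceSet W (2 * k)).filter (fun i => x i = 1)).card : ℝ) ≤
    s₁ / 2 * (1 + 2 * ε) * (firstChoiceSet W (2 * k)).card
  le_first : s₂ / 2 * (1 - 2 * ε) * (firstChoiceSet W (2 * k)).card ≤
    (((firstChoiceSet W (2 * k)).filter (fun i => x i = 2)).card : ℝ)

theorem sum_two_mul (k : Fin p → ℕ) : ∑ l, (2 * k) l = 2 * ∑ l, k l := by
  rw [Finset.mul_sum]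
  rfl

/-- Random labels are balanced with high probability. -/
theorem measureReal_not_isBalanced_le (hp : 0 < p) {W : Fin N → PrefList p}
    {k c₁ c₂ : Fin p → ℕ} (hN : 2 * ∑ l, k l = N) {s₁ s₂ s ε m : ℝ} (hs : 0 < s)
    (hs₁ : s ≤ s₁) (hs₂ : s ≤ s₂) (hsum : s₁ + s₂ ≤ 1) (hc₁ : ∀ l, (c₁ l : ℝ) = s₁ * k l)
    (hc₂ : ∀ l, (c₂ l : ℝ) = s₂ * k l) (hε : 0 < ε) (hε' : ε ≤ 1 / 2) (hm0 : 0 ≤ m)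
    (hm : ∀ l, m ≤ k l) :
    (Measure.pi (fun _ : Fin N => labelLaw (s₁ / 2 * (1 + ε)) (s₂ / 2 * (1 - ε)))).real
      {x | ¬ IsBalanced W k c₁ c₂ s₁ s₂ ε x} ≤
      (2 * p + 2) * Real.exp (-(ε ^ 2 * s ^ 2 * m)) := by
  have ha : 0 ≤ s₁ / 2 * (1 + ε) := by
    have := hs.trans_le hs₁
    positivity
  have hb : 0 ≤ s₂ / 2 * (1 - ε) :=
    mul_nonneg (by linarith) (by linarith)
  -- This is the reason for doubling the capacities: without the halved probabilities the sum could
  -- exceed `1` when `s₁ > s₂`.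
  have hab : s₁ / 2 * (1 + ε) + s₂ / 2 * (1 - ε) ≤ 1 := by nlinarith
  set ν := labelLaw (s₁ / 2 * (1 + ε)) (s₂ / 2 * (1 - ε)) with hν
  have : IsProbabilityMeasure ν := isProbabilityMeasure_labelLaw ha hb hab
  have hi1 : ∫ y, (if y = 1 then (1 : ℝ) else 0) ∂ν = s₁ / 2 * (1 + ε) := by
    rw [hν, integral_labelLaw ha hb hab]
    simp
  have hi2 : ∫ y, (if y = 2 then (1 : ℝ) else 0) ∂ν = s₂ / 2 * (1 - ε) := by
    rw [hν, integral_labelLaw ha hb hab]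
    simp
  have hexp : ∀ (A : Finset (Fin N)) (t : ℝ), s ≤ t → 2 * m ≤ A.card →
      Real.exp (-(2 * (t / 2 * ε) ^ 2 * A.card)) ≤ Real.exp (-(ε ^ 2 * s ^ 2 * m)) := by
    intro A t ht hA
    rw [Real.exp_le_exp, neg_le_neg_iff]
    calc ε ^ 2 * s ^ 2 * m ≤ ε ^ 2 * t ^ 2 * (A.card / 2) := by
          gcongr
          linarith
      _ = _ := by ring
  have hAc : ∀ l, ((assignedSet W (2 * k) l).card : ℝ) = 2 * k l := by
    intro l
    rw [card_assignedSet W _ (by rw [sum_two_mul, hN])]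
    simp
  have hA : ∀ l, 2 * m ≤ (assignedSet W (2 * k) l).card := fun l => by
    rw [hAc]
    linarith [hm l]
  have hF : 2 * m ≤ (firstChoiceSet W (2 * k)).card := by
    obtain ⟨l, -, hl⟩ := Finset.exists_min_image Finset.univ k ⟨⟨0, hp⟩, Finset.mem_univ _⟩
    have h1 : 2 * k l ≤ N := by
      have := Finset.single_le_sum (f := k) (fun i _ => Nat.zero_le _) (Finset.mem_univ l)
      omega
    have h2 := le_card_firstChoiceSet hp W (2 * k) h1 fun l' =>
      Nat.mul_le_mul_left 2 (hl l' (Finset.mem_univ l'))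
    have h3 : ((2 * k l : ℕ) : ℝ) ≤ (firstChoiceSet W (2 * k)).card := by exact_mod_cast h2
    push_cast at h3
    linarith [hm l]
  set E := Real.exp (-(ε ^ 2 * s ^ 2 * m)) with hE
  set μ := Measure.pi (fun _ : Fin N => ν) with hμ
  -- At an institution with `2 * k l` slots, label `1` has mean `s₁ * (1 + ε) * k l`, and a
  -- deviation at this rate reaches exactly `c₁ l`; likewise for label `2` and `c₂ l`. On the set of
  -- first choices the same rates turn `1 ± ε` into `1 ± 2 * ε`.
  have hr1 : 0 ≤ s₁ / 2 * ε := mul_nonneg (by linarith) hε.le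
  have hr2 : 0 ≤ s₂ / 2 * ε := mul_nonneg (by linarith) hε.le
  have b1 : ∀ l, μ.real {x | ((assignedSet W (2 * k) l).filter (fun i => x i = 1)).card ≤
      (c₁ l : ℝ)} ≤ E := by
    intro l
    have h := pi_real_label_le_le ν 1 (assignedSet W (2 * k) l) hr1
    refine (le_of_eq ?_).trans (h.trans (hexp _ _ hs₁ (hA l)))
    rw [hi1, hAc, hc₁]
    congr! 4
    ring
  have b2 : ∀ l, μ.real {x | (c₂ l : ℝ) ≤
      ((assignedSet W (2 * k) l).filter (fun i => x i = 2)).card} ≤ E := by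
    intro l
    have h := pi_real_label_ge_le ν 2 (assignedSet W (2 * k) l) hr2
    refine (le_of_eq ?_).trans (h.trans (hexp _ _ hs₂ (hA l)))
    rw [hi2, hAc, hc₂]
    congr! 4
    ring
  have b3 : μ.real {x | s₁ / 2 * (1 + 2 * ε) * (firstChoiceSet W (2 * k)).card ≤
      ((firstChoiceSet W (2 * k)).filter (fun i => x i = 1)).card} ≤ E := by
    have h := pi_real_label_ge_le ν 1 (firstChoiceSet W (2 * k)) hr1
    refine (le_of_eq ?_).trans (h.trans (hexp _ _ hs₁ hF))
    rw [hi1]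
    congr! 5
    ring
  have b4 : μ.real {x | (((firstChoiceSet W (2 * k)).filter (fun i => x i = 2)).card : ℝ) ≤
      s₂ / 2 * (1 - 2 * ε) * (firstChoiceSet W (2 * k)).card} ≤ E := by
    have h := pi_real_label_le_le ν 2 (firstChoiceSet W (2 * k)) hr2
    refine (le_of_eq ?_).trans (h.trans (hexp _ _ hs₂ hF))
    rw [hi2]
    congr! 5
    ring
  have hsub : {x | ¬ IsBalanced W k c₁ c₂ s₁ s₂ ε x} ⊆
      ((⋃ l, {x | ((assignedSet W (2 * k) l).filter (fun i => x i = 1)).card ≤ (c₁ l : ℝ)}) ∪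
      ⋃ l, {x | (c₂ l : ℝ) ≤ ((assignedSet W (2 * k) l).filter (fun i => x i = 2)).card}) ∪
      ({x | s₁ / 2 * (1 + 2 * ε) * (firstChoiceSet W (2 * k)).card ≤
        ((firstChoiceSet W (2 * k)).filter (fun i => x i = 1)).card} ∪
      {x | (((firstChoiceSet W (2 * k)).filter (fun i => x i = 2)).card : ℝ) ≤
        s₂ / 2 * (1 - 2 * ε) * (firstChoiceSet W (2 * k)).card}) := by
    intro x hx
    by_contra hcon
    simp only [Set.mem_union, Set.mem_iUnion, Set.mem_ofPred_eq, not_or, not_exists,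
      not_le] at hcon
    exact hx ⟨fun l => (hcon.1.1 l).le, fun l => (hcon.1.2 l).le, hcon.2.1.le, hcon.2.2.le⟩
  have hU : ∀ B : Fin p → Set (Fin N → Fin 3), (∀ l, μ.real (B l) ≤ E) →
      μ.real (⋃ l, B l) ≤ p * E := by
    intro B hB
    refine (measureReal_iUnion_fintype_le B).trans ?_
    refine (Finset.sum_le_sum fun l _ => hB l).trans (le_of_eq ?_)
    simp
  calc μ.real {x | ¬ IsBalanced W k c₁ c₂ s₁ s₂ ε x} ≤ _ := measureReal_mono hsub
    _ ≤ _ := measureReal_union_le _ _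
    _ ≤ _ := add_le_add (measureReal_union_le _ _) (measureReal_union_le _ _)
    _ ≤ (p * E + p * E) + (E + E) :=
        add_le_add (add_le_add (hU _ b1) (hU _ b2)) (add_le_add b3 b4)
    _ = _ := by ring

/-- The sequence with label `1` is long enough, and the one with label `2` is short enough. -/
def IsLongShort (c₁ c₂ : Fin p → ℕ) (x : Fin N → Fin 3) : Prop :=
  ∑ l, c₁ l ≤ (labelled x 1).length ∧ (labelled x 2).length ≤ ∑ l, c₂ l

theorem IsBalanced.isLongShort {W : Fin N → PrefList p} {k c₁ c₂ : Fin p → ℕ} {s₁ s₂ ε : ℝ}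
    {x : Fin N → Fin 3} (h : IsBalanced W k c₁ c₂ s₁ s₂ ε x) (hN : 2 * ∑ l, k l = N) :
    IsLongShort c₁ c₂ x := by
  have hN' : ∑ l, (2 * k) l = N := by rw [sum_two_mul, hN]
  constructor
  · rw [length_labelled W _ hN']
    exact Finset.sum_le_sum fun l _ => by exact_mod_cast h.le_one l
  · rw [length_labelled W _ hN']
    exact Finset.sum_le_sum fun l _ => by exact_mod_cast h.two_le l

/-- Class `1` used at least `c₁`, so restricting it to `c₁` can only lose first choices; class `2`
used at most `c₂`, so granting it `c₂` can only gain them. Both counts are then compared with the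
first choices of the full run. -/
theorem IsBalanced.firstChoiceCount_le {W : Fin N → PrefList p} {k c₁ c₂ : Fin p → ℕ}
    {s₁ s₂ ε : ℝ} {x : Fin N → Fin 3} (h : IsBalanced W k c₁ c₂ s₁ s₂ ε x) (hs₁ : 0 ≤ s₁)
    (hs₂ : 0 ≤ s₂) (hε : 0 ≤ ε) (hε' : ε ≤ 1 / 2) :
    s₂ * (1 - 2 * ε) * firstChoiceCount ((labelled x 1).map W) c₁ ≤
      s₁ * (1 + 2 * ε) * firstChoiceCount ((labelled x 2).map W) c₂ := by
  have h1 : (firstChoiceCount ((labelled x 1).map W) c₁ : ℝ) ≤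
      s₁ / 2 * (1 + 2 * ε) * (firstChoiceSet W (2 * k)).card := by
    refine le_trans ?_ h.first_le
    rw [← firstChoiceCount_labelled]
    exact_mod_cast firstChoiceCount_mono _ fun l => by exact_mod_cast h.le_one l
  have h2 : s₂ / 2 * (1 - 2 * ε) * (firstChoiceSet W (2 * k)).card ≤
      (firstChoiceCount ((labelled x 2).map W) c₂ : ℝ) := by
    refine h.le_first.trans ?_
    rw [← firstChoiceCount_labelled]
    exact_mod_cast firstChoiceCount_mono _ fun l => by exact_mod_cast h.two_le l
  calc s₂ * (1 - 2 * ε) * firstChoiceCount ((labelled x 1).map W) c₁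
      ≤ s₂ * (1 - 2 * ε) * (s₁ / 2 * (1 + 2 * ε) * (firstChoiceSet W (2 * k)).card) :=
        mul_le_mul_of_nonneg_left h1 (mul_nonneg hs₂ (by linarith))
    _ = s₁ * (1 + 2 * ε) * (s₂ / 2 * (1 - 2 * ε) * (firstChoiceSet W (2 * k)).card) := by ring
    _ ≤ _ := mul_le_mul_of_nonneg_left h2 (by positivity)

/-- Two disjoint lists of candidates, of which the first is not longer and the second not shorter
than the labelled ones, are no more likely to be out of proportion. -/
theorem measure_firstChoiceCount_lt_le (L : Measure (PrefList p)) [IsProbabilityMeasure L]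
    {c₁ c₂ : Fin p → ℕ} {t₁ t₂ : ℝ} (ht₁ : 0 ≤ t₁) {r₁ r₂ : List (Fin n)}
    (hr : (r₁ ++ r₂).Nodup) (h₁ : ∑ l, c₁ l ≤ r₁.length) (h₂ : ∑ l, c₂ l ≤ r₂.length)
    {x : Fin N → Fin 3} (hx : IsLongShort c₁ c₂ x) :
    Measure.pi (fun _ : Fin n => L) {σ | t₁ * firstChoiceCount (r₂.map σ) c₂ <
        t₂ * firstChoiceCount (r₁.map σ) c₁} ≤
      Measure.pi (fun _ : Fin N => L) {W | t₁ * firstChoiceCount ((labelled x 2).map W) c₂ <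
        t₂ * firstChoiceCount ((labelled x 1).map W) c₁} := by
  set K₁ := ∑ l, c₁ l with hK₁
  set n₂ := (labelled x 2).length with hn₂
  have hx2 : n₂ ≤ r₂.length := hx.2.trans h₂
  -- The event is read off one word cut at position `K₁`, so that its probability depends only on
  -- the length of the word.
  set Q : List (PrefList p) → Prop := fun w =>
    t₁ * firstChoiceCount (w.drop K₁) c₂ < t₂ * firstChoiceCount (w.take K₁) c₁ with hQ
  have hl1 : (r₁.take K₁).length = K₁ := by rw [List.length_take, min_eq_left h₁]
  have hl2 : ((labelled x 1).take K₁).length = K₁ := by rw [List.length_take, min_eq_left hx.1]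
  have hQa : ∀ {m : ℕ} (a b : List (Fin m)) (σ : Fin m → PrefList p), a.length = K₁ →
      (Q ((a ++ b).map σ) ↔ t₁ * firstChoiceCount (b.map σ) c₂ <
        t₂ * firstChoiceCount (a.map σ) c₁) := by
    intro m a b σ ha
    rw [hQ, List.map_append]
    simp only
    rw [List.drop_left' (by rw [List.length_map, ha]), List.take_left' (by rw [List.length_map, ha])]
  have key := pi_setOf_map_eq L (a := r₁.take K₁ ++ r₂.take n₂)
    (b := (labelled x 1).take K₁ ++ labelled x 2)
    (hr.sublist ((List.take_sublist _ _).append (List.take_sublist _ _)))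
    (((nodup_labelled x 1).sublist (List.take_sublist _ _)).append (nodup_labelled x 2)
      (fun _ hi => labelled_disjoint x (h := 1) (h' := 2) (by decide)
        (List.mem_of_mem_take hi)))
    (by rw [List.length_append, List.length_append, hl1, hl2, List.length_take,
      min_eq_left hx2]) Q
  -- Cutting the first list to `K₁` entries changes nothing, as there are only `K₁` slots.
  -- Shortening the second can only lower its count, which enlarges the event.
  calc _ ≤ Measure.pi (fun _ : Fin n => L) {σ | Q ((r₁.take K₁ ++ r₂.take n₂).map σ)} := by
        refine measure_mono fun σ hσ => ?_
        rw [Set.mem_ofPred_eq] at hσ ⊢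
        rw [hQa _ _ _ hl1, List.map_take (l := r₁), firstChoiceCount_take]
        refine lt_of_le_of_lt ?_ hσ
        refine mul_le_mul_of_nonneg_left ?_ ht₁
        have := firstChoiceCount_le_append ((r₂.take n₂).map σ) ((r₂.drop n₂).map σ) c₂
        rw [← List.map_append, List.take_append_drop] at this
        exact_mod_cast this
    _ = _ := key
    _ = _ := by
        congr 1
        ext W
        rw [Set.mem_ofPred_eq, Set.mem_ofPred_eq, hQa _ _ _ hl2, List.map_take,
          firstChoiceCount_take]

/-- The numbers of first choices in two disjoint lists of candidates, run with capacities in the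
proportion `s₁ : s₂`, have nearly this proportion with high probability. -/
theorem measureReal_firstChoiceCount_lt_le (hp : 0 < p) (L : Measure (PrefList p))
    [IsProbabilityMeasure L] {k c₁ c₂ : Fin p → ℕ} {s₁ s₂ s ε m : ℝ} (hs : 0 < s)
    (hs₁ : s ≤ s₁) (hs₂ : s ≤ s₂) (hsum : s₁ + s₂ ≤ 1) (hc₁ : ∀ l, (c₁ l : ℝ) = s₁ * k l)
    (hc₂ : ∀ l, (c₂ l : ℝ) = s₂ * k l) (hε : 0 < ε) (hε' : ε ≤ 1 / 2) (hm0 : 0 ≤ m)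
    (hm : ∀ l, m ≤ k l) {r₁ r₂ : List (Fin n)} (hr : (r₁ ++ r₂).Nodup)
    (h₁ : ∑ l, c₁ l ≤ r₁.length) (h₂ : ∑ l, c₂ l ≤ r₂.length) :
    (Measure.pi (fun _ : Fin n => L)).real
      {σ | s₁ * (1 + 2 * ε) * firstChoiceCount (r₂.map σ) c₂ <
        s₂ * (1 - 2 * ε) * firstChoiceCount (r₁.map σ) c₁} ≤
      2 * ((2 * p + 2) * Real.exp (-(ε ^ 2 * s ^ 2 * m))) := by
  obtain ⟨N, hN⟩ : ∃ N, 2 * ∑ l, k l = N := ⟨_, rfl⟩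
  have hs₁0 : 0 ≤ s₁ := (hs.trans_le hs₁).le
  have hs₂0 : 0 ≤ s₂ := (hs.trans_le hs₂).le
  set ν := labelLaw (s₁ / 2 * (1 + ε)) (s₂ / 2 * (1 - ε)) with hν
  have : IsProbabilityMeasure ν := isProbabilityMeasure_labelLaw (by positivity)
    (mul_nonneg (by linarith) (by linarith)) (by nlinarith)
  set δ := (2 * p + 2) * Real.exp (-(ε ^ 2 * s ^ 2 * m)) with hδ
  have hδ0 : 0 ≤ δ := by positivity
  have hbal : ∀ W : Fin N → PrefList p, Measure.pi (fun _ : Fin N => ν)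
      {x | ¬ IsBalanced W k c₁ c₂ s₁ s₂ ε x} ≤ ENNReal.ofReal δ := by
    intro W
    rw [← ENNReal.ofReal_toReal (measure_ne_top _ {x | ¬ IsBalanced W k c₁ c₂ s₁ s₂ ε x})]
    exact ENNReal.ofReal_le_ofReal (measureReal_not_isBalanced_le hp hN hs hs₁ hs₂ hsum hc₁ hc₂
      hε hε' hm0 hm)
  set t₁ := s₁ * (1 + 2 * ε) with ht₁
  set t₂ := s₂ * (1 - 2 * ε) with ht₂
  -- Lists and labels are independent. Integrating over labels with the lists fixed bounds `B` by
  -- Hoeffding (`hB1`); integrating over lists with the labels fixed bounds `B` from below through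
  -- `P` (`hB2`).
  set B : Set ((Fin N → PrefList p) × (Fin N → Fin 3)) := {z | IsLongShort c₁ c₂ z.2 ∧
    t₁ * firstChoiceCount ((labelled z.2 2).map z.1) c₂ <
      t₂ * firstChoiceCount ((labelled z.2 1).map z.1) c₁} with hB
  set P := Measure.pi (fun _ : Fin n => L)
    {σ | t₁ * firstChoiceCount (r₂.map σ) c₂ < t₂ * firstChoiceCount (r₁.map σ) c₁} with hP
  have hB1 : ((Measure.pi (fun _ : Fin N => L)).prod (Measure.pi (fun _ : Fin N => ν))) B ≤
      ENNReal.ofReal δ := by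
    rw [Measure.prod_apply MeasurableSet.of_discrete]
    refine (lintegral_mono (g := fun _ => ENNReal.ofReal δ) fun W => ?_).trans (by simp)
    refine (measure_mono fun x hx => ?_).trans (hbal W)
    intro hx'
    exact absurd hx.2
      (not_lt.2 (hx'.firstChoiceCount_le hs₁0 hs₂0 hε.le hε'))
  have hB2 : P * Measure.pi (fun _ : Fin N => ν) {x | IsLongShort c₁ c₂ x} ≤
      ((Measure.pi (fun _ : Fin N => L)).prod (Measure.pi (fun _ : Fin N => ν))) B := by
    rw [Measure.prod_apply_symm MeasurableSet.of_discrete,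
      ← lintegral_indicator_const MeasurableSet.of_discrete]
    refine lintegral_mono fun x => ?_
    by_cases hx : IsLongShort c₁ c₂ x
    · rw [Set.indicator_of_mem (by exact hx)]
      refine (measure_firstChoiceCount_lt_le L (by positivity) hr h₁ h₂ hx).trans ?_
      exact measure_mono fun W hW => ⟨hx, hW⟩
    · rw [Set.indicator_of_notMem (by exact hx)]
      exact zero_le
  have hB3 : Measure.pi (fun _ : Fin N => ν) {x | IsLongShort c₁ c₂ x}ᶜ ≤ ENNReal.ofReal δ := by
    -- This event concerns the labels only, so any choice of lists serves.
    refine (measure_mono fun x hx => ?_).trans (hbal fun _ => 1)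
    exact fun hx' => hx (hx'.isLongShort hN)
  have hfin : P ≤ ENNReal.ofReal δ + ENNReal.ofReal δ := by
    calc P = P * (Measure.pi (fun _ : Fin N => ν) {x | IsLongShort c₁ c₂ x} +
          Measure.pi (fun _ : Fin N => ν) {x | IsLongShort c₁ c₂ x}ᶜ) := by
          rw [measure_add_measure_compl MeasurableSet.of_discrete, measure_univ, mul_one]
      _ ≤ _ := by
          rw [mul_add]
          refine add_le_add (hB2.trans hB1) (le_trans ?_ hB3)
          exact mul_le_of_le_one_left zero_le prob_le_one
  rw [← ENNReal.ofReal_add hδ0 hδ0] at hfin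
  rw [measureReal_def]
  refine (ENNReal.toReal_mono ENNReal.ofReal_ne_top hfin).trans (le_of_eq ?_)
  rw [ENNReal.toReal_ofReal (by positivity)]
  ring

end Comparison

/-! ### Measurability -/

section Measurability

variable {n p : ℕ}

/-- All comparisons between the entries of `v`. -/
noncomputable def comparison (v : Fin n → ℝ) : Fin n → Fin n → Bool := fun a b => decide (v b ≤ v a)

theorem measurable_comparison : Measurable (comparison (n := n)) := by
  refine measurable_pi_lambda _ fun a => measurable_pi_lambda _ fun b => ?_
  refine measurable_to_bool ?_
  have : (fun v : Fin n → ℝ => comparison v a b) ⁻¹' {true} = {v | v b ≤ v a} := by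
    ext v
    simp [comparison]
  rw [this]
  exact measurableSet_le (measurable_pi_apply b) (measurable_pi_apply a)

/-- The sort sees `v` only through finitely many comparison bits, and every function of these is
measurable. -/
theorem measurable_comp_ranking (S : Finset (Fin n)) (f : List (Fin n) → ℝ) :
    Measurable fun v => f (ranking v S) :=
  (Measurable.of_discrete (f := fun le : Fin n → Fin n → Bool =>
    f ((S.sort (fun a b => a ≤ b)).mergeSort le))).comp measurable_comparison

theorem measurable_estimated (β : ℝ) (g : Fin n → Fin 2) : Measurable (estimated β g) := by
  refine measurable_pi_lambda _ fun i => ?_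
  unfold estimated
  split_ifs
  · exact measurable_const.mul (measurable_pi_apply i)
  · exact measurable_pi_apply i

theorem measurable_comp_instWise (g : Fin n → Fin 2) (k : Fin p → ℕ) (σ : Fin n → PrefList p)
    (β : ℝ) (f : Assignment n p → ℝ) :
    Measurable fun u => f (instWise g k σ (estimated β g u)) :=
  (Measurable.of_discrete (f := fun le : Fin n → Fin n → Bool =>
    f fun i => serialDictatorship σ (((group g (g i)).sort (fun a b => a ≤ b)).mergeSort le)
      (groupCapacity g k (g i)) i)).comp (measurable_comparison.comp (measurable_estimated β g))

theorem measurable_optUtility (K : ℕ) : Measurable (optUtility (n := n) K) := by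
  have : optUtility (n := n) K = fun u => ∑ i, (if i ∈ (ranking u Finset.univ).take K
      then (1 : ℝ) else 0) * u i := by
    funext u
    rw [optUtility_eq_sum_topSet]
    simp_rw [ite_mul, one_mul, zero_mul, ← mem_topSet]
    rw [Finset.sum_ite_mem, Finset.univ_inter]
  rw [this]
  exact Finset.measurable_sum _ fun i _ => (measurable_comp_ranking _ fun xs =>
    if i ∈ xs.take K then (1 : ℝ) else 0).mul (measurable_pi_apply i)

theorem measurable_utilityQuotient_instWise (g : Fin n → Fin 2) (k : Fin p → ℕ) (β : ℝ)
    (K : ℕ) (σ : Fin n → PrefList p) :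
    Measurable fun u => utilityQuotient K u (instWise g k σ (estimated β g u)) := by
  have hu : Measurable fun u : Fin n → ℝ => utility u (instWise g k σ (estimated β g u)) := by
    have : (fun u : Fin n → ℝ => utility u (instWise g k σ (estimated β g u))) =
        fun u => ∑ i, (if (instWise g k σ (estimated β g u) i).isSome then (1 : ℝ) else 0) *
          u i := by
      funext u
      rw [utility, Finset.sum_filter]
      simp_rw [ite_mul, one_mul, zero_mul]
    rw [this]
    exact Finset.measurable_sum _ fun i _ => (measurable_comp_instWise g k σ β fun M =>
      if (M i).isSome then (1 : ℝ) else 0).mul (measurable_pi_apply i)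
  unfold utilityQuotient
  exact Measurable.ite (measurable_optUtility K (measurableSet_singleton 0)) measurable_const
    (hu.div (measurable_optUtility K))

theorem measurable_prod_of_forall {α ι : Type*} [MeasurableSpace α] [MeasurableSpace ι]
    [Countable ι] [DiscreteMeasurableSpace ι] {f : α × ι → ℝ}
    (hf : ∀ y, Measurable fun x => f (x, y)) : Measurable f :=
  measurable_from_prod_countable_left hf

end Measurability

/-! ### Expectations -/

theorem le_integral_prod_of_le {α ι : Type*} [MeasurableSpace α] [MeasurableSpace ι]
    {μ : Measure α} {ν : Measure ι} [IsProbabilityMeasure μ] [IsProbabilityMeasure ν]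
    {f : α × ι → ℝ} (hf : Integrable f (μ.prod ν)) {c : ℝ}
    (h : ∀ x, c ≤ ∫ y, f (x, y) ∂ν) : c ≤ ∫ z, f z ∂(μ.prod ν) := by
  rw [integral_prod _ hf]
  calc c = ∫ _, c ∂μ := by simp
    _ ≤ _ := integral_mono (integrable_const c) hf.integral_prod_left h

theorem le_integral_prod_symm_of_le {α ι : Type*} [MeasurableSpace α] [MeasurableSpace ι]
    {μ : Measure α} {ν : Measure ι} [IsProbabilityMeasure μ] [IsProbabilityMeasure ν]
    {f : α × ι → ℝ} (hf : Integrable f (μ.prod ν)) {c : ℝ}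
    (h : ∀ y, c ≤ ∫ x, f (x, y) ∂μ) : c ≤ ∫ z, f z ∂(μ.prod ν) := by
  rw [integral_prod_symm _ hf]
  calc c = ∫ _, c ∂ν := by simp
    _ ≤ _ := integral_mono (integrable_const c) hf.integral_prod_right h

theorem minMaxQuotient_mem_Icc {x : Fin 2 → ℝ} (hx : ∀ j, 0 ≤ x j) :
    minMaxQuotient x ∈ Set.Icc (0 : ℝ) 1 := by
  have h1 : 0 ≤ min (x 0) (x 1) := le_min (hx 0) (hx 1)
  have h2 : min (x 0) (x 1) ≤ max (x 0) (x 1) := min_le_max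
  exact ⟨div_nonneg h1 (h1.trans h2), div_le_one_of_le₀ h2 (h1.trans h2)⟩

/-- For `a ≤ b` the hypothesis gives `b - a ≤ 2 * ε * (a + b) ≤ 4 * ε * b`. -/
theorem le_minMaxQuotient {x : Fin 2 → ℝ} (hx : ∀ j, 0 < x j) {ε : ℝ} (hε : 0 ≤ ε)
    (h0 : (1 - 2 * ε) * x 0 ≤ (1 + 2 * ε) * x 1) (h1 : (1 - 2 * ε) * x 1 ≤ (1 + 2 * ε) * x 0) :
    1 - 4 * ε ≤ minMaxQuotient x := by
  have key : ∀ a b : ℝ, 0 < a → a ≤ b → (1 - 2 * ε) * b ≤ (1 + 2 * ε) * a →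
      1 - 4 * ε ≤ a / b := by
    intro a b ha hab h
    rw [le_div_iff₀ (ha.trans_le hab)]
    nlinarith [mul_nonneg hε (sub_nonneg.2 hab)]
  unfold minMaxQuotient
  rcases le_total (x 0) (x 1) with h | h
  · rw [min_eq_left h, max_eq_right h]
    exact key _ _ (hx 0) h h1
  · rw [min_eq_right h, max_eq_left h]
    exact key _ _ (hx 1) h h0

theorem firstChoiceFraction_nonneg {n p : ℕ} (g : Fin n → Fin 2) (σ : Fin n → PrefList p)
    (M : Assignment n p) (j : Fin 2) : 0 ≤ firstChoiceFraction g σ M j := by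
  unfold firstChoiceFraction
  positivity

/-- Evaluates the failure bound at `ε = 2 * y`, where `y` is the error term of the theorem. The
exponent is then at least `4 * log K`, and the resulting `K ^ (-4)` absorbs the union bound over the
institutions. -/
theorem two_mul_add_two_mul_exp_le {K p a b : ℝ} (ha : 0 < a) (hb : 0 < b) (hbp : b * p ≤ 1)
    (hp : 1 ≤ p) (hK : 2 ≤ K) (hpK : 2 * p ≤ K) :
    (2 * p + 2) * Real.exp (-((2 * (p * √(Real.log K) / (a * b * √K))) ^ 2 * a ^ 2 * (b * K))) ≤
      1 / K := by
  have hK0 : 0 < K := by linarith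
  have hlog : 0 ≤ Real.log K := Real.log_nonneg (by linarith)
  have hb1 : b ≤ 1 := (le_mul_of_one_le_right hb.le hp).trans hbp
  have h1 : (2 * (p * √(Real.log K) / (a * b * √K))) ^ 2 * a ^ 2 * (b * K) =
      4 * p ^ 2 * Real.log K / b := by
    rw [mul_pow, div_pow, mul_pow, mul_pow, mul_pow, Real.sq_sqrt hlog, Real.sq_sqrt hK0.le]
    field_simp
    ring
  have h2 : 4 * Real.log K ≤ 4 * p ^ 2 * Real.log K / b := by
    rw [le_div_iff₀ hb]
    have h3 : 4 * Real.log K * b ≤ 4 * Real.log K := mul_le_of_le_one_right (by positivity) hb1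
    have h4 : 1 * (4 * Real.log K) ≤ p ^ 2 * (4 * Real.log K) :=
      mul_le_mul_of_nonneg_right (one_le_pow₀ hp) (by positivity)
    linarith
  have hexp : Real.exp (-(4 * p ^ 2 * Real.log K / b)) ≤ 1 / K ^ 4 := by
    refine (Real.exp_le_exp.2 (neg_le_neg h2)).trans (le_of_eq ?_)
    rw [Real.exp_neg, one_div, show (4 : ℝ) * Real.log K = ((4 : ℕ) : ℝ) * Real.log K by norm_num,
      Real.exp_nat_mul, Real.exp_log hK0]
  rw [h1]
  calc (2 * p + 2) * Real.exp (-(4 * p ^ 2 * Real.log K / b)) ≤ (2 * K) * (1 / K ^ 4) :=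
        mul_le_mul (by linarith) hexp (Real.exp_pos _).le (by positivity)
    _ ≤ 1 / K := by
        rw [mul_one_div, div_le_div_iff₀ (by positivity) hK0, one_mul]
        have hKK : 2 ≤ K * K := by nlinarith
        have := mul_le_mul_of_nonneg_right hKK (mul_nonneg hK0.le hK0.le)
        calc 2 * K * K = 2 * (K * K) := by ring
          _ ≤ K * K * (K * K) := this
          _ = K ^ 4 := by ring

/-! ### Expected fairness and utility -/

section Main

variable {n p : ℕ} {g : Fin n → Fin 2} {k : Fin p → ℕ}

theorem groupCapacity_pos (hk : ∀ (j : Fin 2) (l : Fin p), n ∣ k l * (group g j).card)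
    (hn : 0 < n) (hg : ∀ j, 0 < (group g j).card) (hk0 : ∀ l, 0 < k l) (j : Fin 2)
    (l : Fin p) : 0 < groupCapacity g k j l :=
  Nat.div_pos (Nat.le_of_dvd (Nat.mul_pos (hk0 l) (hg j)) (hk j l)) hn

/-- Both groups get a slot at every institution. -/
theorem two_mul_le_sum (hk : ∀ (j : Fin 2) (l : Fin p), n ∣ k l * (group g j).card)
    (hn : 0 < n) (hg : ∀ j, 0 < (group g j).card) (hk0 : ∀ l, 0 < k l) :
    2 * p ≤ ∑ l, k l := by
  rw [← sum_groupTotal hk hn, Fin.sum_univ_two]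
  have : ∀ j, p ≤ groupTotal g k j := fun j => by
    calc p = ∑ _ : Fin p, 1 := by simp
      _ ≤ _ := Finset.sum_le_sum fun l _ => groupCapacity_pos hk hn hg hk0 j l
  have h0 := this 0
  have h1 := this 1
  omega

/-- For fixed `v` both rankings are deterministic and disjoint, so the comparison of two i.i.d.
words applies in both orders. On the exceptional set the quotient is only known to be nonnegative.
-/
theorem integral_minMaxQuotient_firstChoiceFraction_ge (hp : 0 < p)
    (hk : ∀ (j : Fin 2) (l : Fin p), n ∣ k l * (group g j).card) (hn : 0 < n)
    (hK : ∑ l, k l ≤ n) (hk0 : ∀ l, 0 < k l) {s ε m : ℝ} (hs : 0 < s)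
    (hsg : ∀ j, s ≤ ((group g j).card : ℝ) / n) (hε : 0 < ε) (hε' : ε ≤ 1 / 2) (hm0 : 0 ≤ m)
    (hm : ∀ l, m ≤ k l) (L : Measure (PrefList p)) [IsProbabilityMeasure L] (v : Fin n → ℝ) :
    1 - 4 * ε - 4 * ((2 * p + 2) * Real.exp (-(ε ^ 2 * s ^ 2 * m))) ≤
      ∫ σ, minMaxQuotient (firstChoiceFraction g σ (instWise g k σ v))
        ∂(Measure.pi (fun _ : Fin n => L)) := by
  set μ := Measure.pi (fun _ : Fin n => L) with hμ
  have hn' : (0 : ℝ) < n := by exact_mod_cast hn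
  have hgr : ∀ j, (0 : ℝ) < (group g j).card := fun j => by
    have := hs.trans_le (hsg j)
    by_contra! h
    have h0 : ((group g j).card : ℝ) = 0 := le_antisymm h (by positivity)
    rw [h0, zero_div] at this
    exact this.false
  have hg : ∀ j, 0 < (group g j).card := fun j => by exact_mod_cast hgr j
  set F : Fin 2 → (Fin n → PrefList p) → ℝ := fun j σ =>
    firstChoiceCount ((ranking v (group g j)).map σ) (groupCapacity g k j) with hF
  have hsum : ((group g 0).card : ℝ) / n + ((group g 1).card : ℝ) / n = 1 := by
    rw [← add_div, div_eq_one_iff_eq hn'.ne']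
    have := sum_card_group g
    rw [Fin.sum_univ_two] at this
    exact_mod_cast this
  have hbad : ∀ j j' : Fin 2, j ≠ j' → μ.real
      {σ | ((group g j).card : ℝ) / n * (1 + 2 * ε) * F j' σ <
        ((group g j').card : ℝ) / n * (1 - 2 * ε) * F j σ} ≤
      2 * ((2 * p + 2) * Real.exp (-(ε ^ 2 * s ^ 2 * m))) := by
    intro j j' hj
    refine measureReal_firstChoiceCount_lt_le hp L hs (hsg j) (hsg j') ?_
      (cast_groupCapacity hk hn j) (cast_groupCapacity hk hn j') hε hε' hm0 hm ?_ ?_ ?_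
    · fin_cases j <;> fin_cases j' <;> first | exact absurd rfl hj | skip
      · exact hsum.le
      · rw [add_comm]
        exact hsum.le
    · refine (ranking_nodup _ _).append (ranking_nodup _ _) fun i hi hi' => hj ?_
      rw [mem_ranking, mem_group] at hi hi'
      exact hi.symm.trans hi'
    · rw [length_ranking]
      exact groupTotal_le_card hk hn hK j
    · rw [length_ranking]
      exact groupTotal_le_card hk hn hK j'
  set B : Set (Fin n → PrefList p) :=
    {σ | ((group g 0).card : ℝ) / n * (1 + 2 * ε) * F 1 σ <
        ((group g 1).card : ℝ) / n * (1 - 2 * ε) * F 0 σ} ∪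
    {σ | ((group g 1).card : ℝ) / n * (1 + 2 * ε) * F 0 σ <
        ((group g 0).card : ℝ) / n * (1 - 2 * ε) * F 1 σ} with hB
  have hBμ : μ.real B ≤ 4 * ((2 * p + 2) * Real.exp (-(ε ^ 2 * s ^ 2 * m))) := by
    have h1 := hbad 0 1 (by decide)
    have h2 := hbad 1 0 (by decide)
    have h3 := measureReal_union_le (μ := μ) {σ | ((group g 0).card : ℝ) / n * (1 + 2 * ε) * F 1 σ <
        ((group g 1).card : ℝ) / n * (1 - 2 * ε) * F 0 σ}
      {σ | ((group g 1).card : ℝ) / n * (1 + 2 * ε) * F 0 σ <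
        ((group g 0).card : ℝ) / n * (1 - 2 * ε) * F 1 σ}
    linarith
  have hpath : ∀ σ, (1 - 4 * ε) - B.indicator 1 σ ≤
      minMaxQuotient (firstChoiceFraction g σ (instWise g k σ v)) := by
    intro σ
    by_cases hσ : σ ∈ B
    · have := (minMaxQuotient_mem_Icc (firstChoiceFraction_nonneg g σ (instWise g k σ v))).1
      rw [Set.indicator_of_mem hσ, Pi.one_apply]
      linarith
    · rw [Set.indicator_of_notMem hσ, sub_zero]
      simp only [hB, Set.mem_union, Set.mem_ofPred_eq, not_or, not_lt] at hσ
      -- The top candidate of each group gets its first choice, which rules out the quotient `0 /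
      -- 0`.
      have hpos : ∀ j, 0 < F j σ := fun j => by
        have := le_firstChoiceCount hp 1 ((ranking v (group g j)).map σ) (groupCapacity g k j)
          (fun l => groupCapacity_pos hk hn hg hk0 j l)
          (by rw [List.length_map, length_ranking]; exact hg j)
        exact Nat.cast_pos.2 this
      have key : ∀ j j' : Fin 2, ((group g j').card : ℝ) / n * (1 - 2 * ε) * F j σ ≤
          ((group g j).card : ℝ) / n * (1 + 2 * ε) * F j' σ →
          (1 - 2 * ε) * firstChoiceFraction g σ (instWise g k σ v) j ≤
          (1 + 2 * ε) * firstChoiceFraction g σ (instWise g k σ v) j' := by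
        intro j j' h
        rw [firstChoiceFraction_instWise, firstChoiceFraction_instWise, mul_div_assoc',
          mul_div_assoc', div_le_div_iff₀ (hgr j) (hgr j')]
        have h' := mul_le_mul_of_nonneg_right h hn'.le
        field_simp at h'
        linarith
      refine le_minMaxQuotient (fun j => ?_) hε.le (key 0 1 hσ.1) (key 1 0 hσ.2)
      rw [firstChoiceFraction_instWise]
      exact div_pos (hpos j) (hgr j)
  calc _ ≤ (1 - 4 * ε) - μ.real B := by linarith
    _ = ∫ σ, ((1 - 4 * ε) - B.indicator 1 σ) ∂μ := by
        rw [integral_sub (integrable_const _) Integrable.of_finite,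
          integral_indicator_one MeasurableSet.of_discrete]
        simp
    _ ≤ _ := integral_mono Integrable.of_finite Integrable.of_finite hpath

/-- The product law is invariant under permutations of the candidates, so the integrand may be
replaced by its average over all permutations, which is bounded pointwise. -/
theorem integral_utilityQuotient_ge
    (hk : ∀ (j : Fin 2) (l : Fin p), n ∣ k l * (group g j).card) (hn : 0 < n)
    (hK : ∑ l, k l ≤ n) (hK0 : 0 < ∑ l, k l) {β : ℝ} (hβ : 0 < β) (D : Measure ℝ)
    [IsProbabilityMeasure D] (hD : ∀ᵐ u ∂(Measure.pi (fun _ : Fin n => D)), ∀ i, 0 ≤ u i)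
    (σ : Fin n → PrefList p) :
    1 - 1 / √((∑ l, k l : ℕ) : ℝ) ≤
      ∫ u, utilityQuotient (∑ l, k l) u (instWise g k σ (estimated β g u))
        ∂(Measure.pi (fun _ : Fin n => D)) := by
  set μ := Measure.pi (fun _ : Fin n => D) with hμ
  set q : (Fin n → ℝ) → ℝ := fun u =>
    utilityQuotient (∑ l, k l) u (instWise g k σ (estimated β g u)) with hq
  have hqm : Measurable q := measurable_utilityQuotient_instWise g k β _ σ
  have hqi : Integrable q μ := Integrable.of_mem_Icc 0 1 hqm.aemeasurable
    (hD.mono fun u hu => utilityQuotient_instWise_mem_Icc hk hn hK σ _ hu)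
  have hmp : ∀ π : Equiv.Perm (Fin n), MeasurePreserving (fun u : Fin n → ℝ => u ∘ π) μ μ :=
    fun π => ⟨measurable_pi_lambda _ fun i => measurable_pi_apply _,
      map_pi_precomp D π.injective⟩
  have hint : ∀ π : Equiv.Perm (Fin n), ∫ u, q (u ∘ π) ∂μ = ∫ u, q u ∂μ := by
    intro π
    conv_rhs => rw [← (hmp π).map_eq]
    rw [integral_map (hmp π).measurable.aemeasurable hqm.aestronglyMeasurable]
  have hi : ∀ π : Equiv.Perm (Fin n), Integrable (fun u => q (u ∘ π)) μ := fun π =>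
    (hmp π).integrable_comp_of_integrable hqi
  refine le_of_mul_le_mul_left (a := (Fintype.card (Equiv.Perm (Fin n)) : ℝ)) ?_
    (by exact_mod_cast Fintype.card_pos)
  calc (Fintype.card (Equiv.Perm (Fin n)) : ℝ) * (1 - 1 / √((∑ l, k l : ℕ) : ℝ))
      = ∫ _, (Fintype.card (Equiv.Perm (Fin n)) : ℝ) * (1 - 1 / √((∑ l, k l : ℕ) : ℝ)) ∂μ := by
        simp
    _ ≤ ∫ u, ∑ π : Equiv.Perm (Fin n), q (u ∘ π) ∂μ := by
        refine integral_mono_ae (integrable_const _) (integrable_finsetSum _ fun π _ => hi π) ?_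
        exact hD.mono fun u hu => le_sum_perm_utilityQuotient hk hn hK hK0 hβ σ hu
    _ = _ := by
        rw [integral_finsetSum _ fun π _ => hi π, Finset.sum_congr rfl fun π _ => hint π]
        simp

end Main

end Selection

open Selection in
theorem mainTheorem1 :
    ∃ C : ℝ, 0 < C ∧
      ∀ (n p : ℕ) (g : Fin n → Fin 2) (k : Fin p → ℕ) (K : ℕ) (η₁ η₂ η₃ : ℝ),
        0 < n → K = ∑ l, k l → K ≤ n →
        (∀ (j : Fin 2) (l : Fin p), n ∣ k l * (Selection.group g j).card) →
        0 < η₁ → 0 < η₂ → 0 < η₃ →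
        (∀ j : Fin 2, η₁ * (n : ℝ) ≤ ((Selection.group g j).card : ℝ)) →
        η₂ * (n : ℝ) ≤ (K : ℝ) →
        (∀ l : Fin p, η₃ * (K : ℝ) ≤ (k l : ℝ)) →
        ∀ (D : MeasureTheory.Measure ℝ) [MeasureTheory.IsProbabilityMeasure D]
          (L : MeasureTheory.Measure (Selection.PrefList p))
          [MeasureTheory.IsProbabilityMeasure L] (β : ℝ),
          (∀ᵐ x ∂D, 0 ≤ x) → 0 < β →
          1 - C * ((p : ℝ) * √(Real.log K) / (η₁ * η₃ * √(K : ℝ))) ≤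
              Selection.preferenceFairness D L β g (Selection.instWise g k) ∧
            1 - C * (√(Real.log n) / √(η₂ * (n : ℝ))) ≤
              Selection.utilityRatio D L β g K (Selection.instWise g k) ∧
            Selection.representationalFairness D L β g (Selection.instWise g k) = 1 := by
  -- With `ε = 2 * y` the loss is `4 * ε = 8 * y`, plus `4 / K ≤ 4 * y` from the exceptional set.
  -- The utility bound needs less.
  refine ⟨12, by norm_num, ?_⟩
  intro n p g k K η₁ η₂ η₃ hn hKk hKn hk hη₁ hη₂ hη₃ hg hK hkl D _ L _ β hD hβ
  subst hKk
  have hn' : (0 : ℝ) < n := by exact_mod_cast hn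
  have hKr : (0 : ℝ) < (∑ l, k l : ℕ) := (by positivity : 0 < η₂ * (n : ℝ)).trans_le hK
  have hK0 : 0 < ∑ l, k l := by exact_mod_cast hKr
  have hp : 0 < p := by
    rcases Nat.eq_zero_or_pos p with rfl | h
    · simp at hK0
    · exact h
  have hk0 : ∀ l, 0 < k l := fun l => by
    have := (mul_pos hη₃ hKr).trans_le (hkl l)
    exact_mod_cast this
  have hg0 : ∀ j, 0 < (group g j).card := fun j => by
    have := (mul_pos hη₁ hn').trans_le (hg j)
    exact_mod_cast this
  have hsg : ∀ j, η₁ ≤ ((group g j).card : ℝ) / n := fun j => (le_div_iff₀ hn').2 (hg j)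
  have h2p : 2 * p ≤ ∑ l, k l := two_mul_le_sum hk hn hg0 hk0
  have hη₁' : η₁ ≤ 1 / 2 := by
    have h := sum_card_group g
    rw [Fin.sum_univ_two] at h
    have h' : ((group g 0).card : ℝ) + (group g 1).card = n := by exact_mod_cast h
    nlinarith [hg 0, hg 1]
  have hη₃' : η₃ * p ≤ 1 := by
    have h : ∑ _l : Fin p, η₃ * ((∑ l, k l : ℕ) : ℝ) ≤ ∑ l, (k l : ℝ) :=
      Finset.sum_le_sum fun l _ => hkl l
    rw [Finset.sum_const, Finset.card_univ, Fintype.card_fin, nsmul_eq_mul,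
      ← Nat.cast_sum] at h
    nlinarith
  have hDpi : ∀ᵐ u ∂(MeasureTheory.Measure.pi (fun _ : Fin n => D)), ∀ i, 0 ≤ u i := by
    rw [MeasureTheory.ae_all_iff]
    exact fun i => (MeasureTheory.measurePreserving_eval
      (fun _ : Fin n => D) i).quasiMeasurePreserving.ae hD
  set K := ∑ l, k l with hKdef
  have hK2 : (2 : ℝ) ≤ K := by
    have : 2 ≤ K := by omega
    exact_mod_cast this
  have hpr : (1 : ℝ) ≤ p := by exact_mod_cast hp
  have hnr : (2 : ℝ) ≤ n := hK2.trans (by exact_mod_cast hKn)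
  have hsqrtlog : ∀ x : ℝ, 2 ≤ x → 1 / 2 ≤ √(Real.log x) := fun x hx => by
    have := Real.log_le_log (by norm_num) hx
    exact Real.le_sqrt_of_sq_le (by linarith [Real.log_two_gt_d9])
  have hsqrtK : 0 < √(K : ℝ) := Real.sqrt_pos.2 hKr
  refine ⟨?_, ?_, ?_⟩
  · set y := (p : ℝ) * √(Real.log K) / (η₁ * η₃ * √(K : ℝ)) with hy
    have hη₃1 : η₃ ≤ 1 := (le_mul_of_one_le_right hη₃.le hpr).trans hη₃'
    have hyK : 1 / (K : ℝ) ≤ y := by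
      have h1 : 1 / (K : ℝ) ≤ 1 / √(K : ℝ) := by
        refine one_div_le_one_div_of_le hsqrtK ?_
        rw [Real.sqrt_le_left hKr.le]
        nlinarith
      refine h1.trans ?_
      rw [hy, div_le_div_iff₀ hsqrtK (by positivity), one_mul]
      refine mul_le_mul_of_nonneg_right ?_ hsqrtK.le
      have h2 := hsqrtlog K hK2
      have h3 : 1 / 2 ≤ (p : ℝ) * √(Real.log K) :=
        h2.trans (le_mul_of_one_le_left (by positivity) hpr)
      nlinarith
    have hy0 : 0 < y := lt_of_lt_of_le (by positivity) hyK
    unfold preferenceFairness instanceLaw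
    have hf : ∀ z : (Fin n → ℝ) × (Fin n → PrefList p),
        minMaxQuotient (firstChoiceFraction g z.2 (instWise g k z.2 (estimated β g z.1))) ∈
          Set.Icc (0 : ℝ) 1 := fun z => minMaxQuotient_mem_Icc (firstChoiceFraction_nonneg _ _ _)
    -- For `y > 1 / 4` the bound is negative and hence trivial; otherwise `ε = 2 * y` satisfies `ε ≤
    -- 1 / 2`.
    rcases lt_or_ge (1 / 4) y with hy4 | hy4
    · refine le_trans (by linarith) (MeasureTheory.integral_nonneg fun z => (hf z).1)
    refine le_integral_prod_of_le (MeasureTheory.Integrable.of_mem_Icc 0 1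
      (measurable_prod_of_forall fun σ => measurable_comp_instWise g k σ β
        fun M => minMaxQuotient (firstChoiceFraction g σ M)).aemeasurable
      (Filter.Eventually.of_forall hf)) fun u => ?_
    have hmain := integral_minMaxQuotient_firstChoiceFraction_ge hp hk hn hKn hk0 hη₁ hsg
      (ε := 2 * y) (mul_pos two_pos hy0) (by linarith) (m := η₃ * K) (mul_pos hη₃ hKr).le hkl L
      (estimated β g u)
    refine le_trans ?_ hmain
    have hδ := two_mul_add_two_mul_exp_le (K := (K : ℝ)) hη₁ hη₃ hη₃' hpr hK2
      (by exact_mod_cast h2p)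
    have := hδ.trans hyK
    linarith
  · have hlow : 1 - 12 * (√(Real.log n) / √(η₂ * (n : ℝ))) ≤ 1 - 1 / √(K : ℝ) := by
      have h1 := hsqrtlog n hnr
      have h2 : 0 < √(η₂ * (n : ℝ)) := Real.sqrt_pos.2 (by positivity)
      have h3 : √(η₂ * (n : ℝ)) ≤ √(K : ℝ) := Real.sqrt_le_sqrt hK
      have h4 : 1 / √(K : ℝ) ≤ 1 / √(η₂ * (n : ℝ)) := one_div_le_one_div_of_le h2 h3
      have h5 : 1 / √(η₂ * (n : ℝ)) ≤ 12 * (√(Real.log n) / √(η₂ * (n : ℝ))) := by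
        rw [mul_div_assoc']
        exact div_le_div_of_nonneg_right (by linarith) h2.le
      linarith
    refine hlow.trans ?_
    unfold utilityRatio instanceLaw
    refine le_integral_prod_symm_of_le (MeasureTheory.Integrable.of_mem_Icc 0 1
      (measurable_prod_of_forall fun σ =>
        measurable_utilityQuotient_instWise g k β K σ).aemeasurable ?_)
      fun σ => integral_utilityQuotient_ge hk hn hKn hK0 hβ D hDpi σ
    exact (MeasureTheory.Measure.quasiMeasurePreserving_fst.ae hDpi).mono fun z hz =>
      utilityQuotient_instWise_mem_Icc hk hn hKn z.2 _ hz
  · unfold representationalFairness instanceLaw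
    have hone : ∀ z : (Fin n → ℝ) × (Fin n → PrefList p),
        minMaxQuotient (selectedFraction g (instWise g k z.2 (estimated β g z.1))) = 1 := by
      intro z
      rw [minMaxQuotient, selectedFraction_instWise hk hn hKn (hg0 0),
        selectedFraction_instWise hk hn hKn (hg0 1), min_self, max_self]
      exact div_self (div_pos hKr hn').ne'
    simp only [hone]
    simp
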